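/- Let $\mathbf K=[-1,1]^n$, let $d\mu(\mathbf x)=\prod_{i=1}^n\frac{dx_i}{\pi\sqrt{1-x_i^2}}$ on $\mathbf K$, and for $\alpha\in\mathbb N_0^n$ put $|\alpha|=\sum_i\alpha_i$ and $T_\alpha(\mathbf x)=\prod_i T_{\alpha_i}(x_i)$, $\hat T_\alpha(\mathbf x)=\prod_i\hat T_{\alpha_i}(x_i)$, where $T_k$ is the $k$-th Chebyshev polynomial of the first kind, $\hat T_0=T_0$ and $\hat T_k=\sqrt2\,T_k$ for $k\ge1$. For $f=\sum_\alpha f_\alpha T_\alpha\in\mathbb R[\mathbf x]$ let $\|f\|_{1,T}=\sum_\alpha|f_\alpha|$ and $f_{\min}=\min_{\mathbf K}f$. Let $\mathcal T_r=\mathcal T(1\pm x_1,\dots,1\pm x_n)_r$ be the set of polynomials of the form $\sum_{I\subseteq[2n]}\sigma_I\prod_{i\in I}g_i$, where $g_1,\dots,g_{2n}$ are the polynomials $1-x_i$ and $1+x_i$ $(1\le i\le n)$, each $\sigma_I$ is a sum of squares of polynomials, and each summand $\sigma_I\prod_{i\in I}g_i$ has degree at most $r$. Let $\hat f_{(r)}=\sup\{\lambda\in\mathbb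 R: f-\lambda\in\mathcal T_r\}$ (a supremum in $[-\infty,\infty]$). For $\lambda_\alpha\in[0,1]$ $(|\alpha|\le r)$ with $\lambda_{\mathbf 0}=1$ let $K_r(\mathbf x,\mathbf y)=\sum_{|\alpha|\le r}\lambda_\alpha\hat T_\alpha(\mathbf x)\hat T_\alpha(\mathbf y)$. Call $(\lambda_\alpha)$ feasible for $(n,d,r)$ if $\int_{\mathbf K}f(\mathbf y)K_r(\,\cdot\,,\mathbf y)\,d\mu(\mathbf y)\in\mathcal T_r$ for every polynomial $f$ of degree at most $d$ that is nonnegative on $\mathbf K$, and let $$\Theta^r_{n,d}=\inf\Big\{\max_{|\alpha|\le d}|1-\lambda_\alpha| : (\lambda_\alpha)\text{ feasible for }(n,d,r)\Big\},$$ where $\lambda_\alpha:=0$ for $|\alpha|>r$. Let $n,r,d$ be nonnegative integers with $\pi d<r+2$. Then $$\Theta^{rn}_{n,d}\le\frac{\pi^2d^2}{(r+2)^2}.$$ This bound is witnessed by the product of univariate Jackson kernels: with $\theta_r=\frac{\pi}{r+2}$, $\lambda^r_0=1$, $$\lambda^r_k=\frac1{r+2}\Big((r+2-k)\cos(k\theta_r)+\frac{\sin(k\theta_r)}{\sin\theta_r}\cos\theta_r\Big)\quad(1\le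 k\le r),\qquad \lambda^r_k=0\quad(k>r),$$ and $\lambda^r_\alpha=\prod_i\lambda^r_{\alpha_i}$, one has $$\sum_{|\alpha|\le rn}\lambda^r_\alpha\hat T_\alpha(\mathbf x)\hat T_\alpha(\mathbf y)=\prod_{i=1}^n\Big(1+\sum_{k=1}^r\lambda^r_k\hat T_k(x_i)\hat T_k(y_i)\Big),$$ the family $(\lambda^r_\alpha)$ is feasible for $(n,d,rn)$, and $\max_{|\alpha|\le d}|1-\lambda^r_\alpha|\le\frac{\pi^2d^2}{(r+2)^2}$. Consequently, for every $f\in\mathbb R[\mathbf x]$ of degree at most $d$, $$f_{\min}-\hat f_{(rn)}\le\|f\|_{1,T}\,\frac{\pi^2d^2}{(r+2)^2}.$$ -/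

import Mathlib

noncomputable section

namespace HypercubeHierarchy

open MvPolynomial

/-! ## Multi-indices, the hypercube, Chebyshev polynomials -/

/-- The multi-indices `α ∈ ℕ₀ⁿ` with `|α| = α₁ + ⋯ + αₙ ≤ d`. -/
def multiIndices (n d : ℕ) : Finset (Fin n → ℕ) :=
  (Fintype.piFinset fun _ => Finset.range (d + 1)).filter fun α => ∑ i, α i ≤ d

theorem mem_multiIndices {n d : ℕ} {α : Fin n → ℕ} :
    α ∈ multiIndices n d ↔ ∑ i, α i ≤ d := by
  simp only [multiIndices, Finset.mem_filter, Fintype.mem_piFinset, Finset.mem_range,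
    and_iff_right_iff_imp]
  intro h i
  have := Finset.single_le_sum (f := α) (fun j _ => Nat.zero_le _) (Finset.mem_univ i)
  omega

theorem zero_mem_multiIndices (n d : ℕ) : (0 : Fin n → ℕ) ∈ multiIndices n d := by
  simp [mem_multiIndices]

/-- The hypercube `K = [-1,1]ⁿ`. -/
def cube (n : ℕ) : Set (Fin n → ℝ) := Set.Icc (fun _ => -1) (fun _ => 1)

/-- The multivariate Chebyshev polynomial `T_α = ∏ T_{α_i}(x_i)`. -/
def chebT {n : ℕ} (α : Fin n → ℕ) : MvPolynomial (Fin n) ℝ :=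
  ∏ i, Polynomial.aeval (X i : MvPolynomial (Fin n) ℝ) (Polynomial.Chebyshev.T ℝ (α i : ℤ))

/-- The normalized univariate Chebyshev polynomial: `T̂₀ = T₀` and `T̂ₖ = √2 Tₖ` for `k ≥ 1`,
as a function on `ℝ`. -/
def normT (k : ℕ) (t : ℝ) : ℝ :=
  (if k = 0 then 1 else Real.sqrt 2) * (Polynomial.Chebyshev.T ℝ (k : ℤ)).eval t

/-- `T̂_α(x) = ∏ T̂_{α_i}(x_i)`. -/
def normTMulti {n : ℕ} (α : Fin n → ℕ) (x : Fin n → ℝ) : ℝ := ∏ i, normT (α i) (x i)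

/-! ## The Chebyshev basis of the polynomial ring -/

/-- The univariate Chebyshev polynomials as a sequence with `deg T_k = k`. -/
def chebSeq : Polynomial.Sequence ℝ where
  elems' k := Polynomial.Chebyshev.T ℝ (k : ℤ)
  degree_eq' k := by simp

/-- The univariate Chebyshev basis. -/
def chebBasisOne : Module.Basis ℕ ℝ (Polynomial ℝ) :=
  chebSeq.basis fun k => by
    rw [isUnit_iff_ne_zero, Polynomial.leadingCoeff_ne_zero]
    exact chebSeq.ne_zero k

theorem chebBasisOne_apply (k : ℕ) :
    chebBasisOne k = Polynomial.Chebyshev.T ℝ (k : ℤ) := by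
  simp only [chebBasisOne, Polynomial.Sequence.basis_eq_self]
  rfl

/-- The product functional on `ℝ[x₁,…,xₙ]` built from univariate coordinate functionals. -/
def coordFun {n : ℕ} (α : Fin n → ℕ) : MvPolynomial (Fin n) ℝ →ₗ[ℝ] ℝ :=
  (MvPolynomial.basisMonomials (Fin n) ℝ).constr ℝ
    fun β => ∏ i, chebBasisOne.coord (α i) (Polynomial.X ^ (β i))

theorem prod_X_pow_eq {n : ℕ} (β : Fin n → ℕ) :
    (∏ i, (X i : MvPolynomial (Fin n) ℝ) ^ β i) =
      MvPolynomial.basisMonomials (Fin n) ℝ (Finsupp.equivFunOnFinite.symm β) := by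
  rw [MvPolynomial.coe_basisMonomials]
  change _ = MvPolynomial.monomial (Finsupp.equivFunOnFinite.symm β) (1 : ℝ)
  rw [MvPolynomial.monomial_eq, Finsupp.prod_fintype]
  · simp
  · simp

theorem coordFun_prod {n : ℕ} (α : Fin n → ℕ) (p : Fin n → Polynomial ℝ) :
    coordFun α (∏ i, Polynomial.aeval (X i : MvPolynomial (Fin n) ℝ) (p i)) =
      ∏ i, chebBasisOne.coord (α i) (p i) := by
  have h1 : ∀ i, Polynomial.aeval (X i : MvPolynomial (Fin n) ℝ) (p i) =
      ∑ k ∈ (p i).support, (p i).coeff k • (X i : MvPolynomial (Fin n) ℝ) ^ k := fun i => by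
    rw [Polynomial.aeval_def, Polynomial.eval₂_eq_sum, Polynomial.sum]
    exact Finset.sum_congr rfl fun k _ => (Algebra.smul_def _ _).symm
  have h2 : ∀ i, chebBasisOne.coord (α i) (p i) =
      ∑ k ∈ (p i).support, (p i).coeff k * chebBasisOne.coord (α i) (Polynomial.X ^ k) := fun i => by
    conv_lhs => rw [(p i).as_sum_support_C_mul_X_pow]
    rw [map_sum]
    refine Finset.sum_congr rfl fun k _ => ?_
    rw [← Polynomial.smul_eq_C_mul, map_smul, smul_eq_mul]
  simp_rw [h1, h2]
  rw [Finset.prod_univ_sum, Finset.prod_univ_sum, map_sum]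
  refine Finset.sum_congr rfl fun β _ => ?_
  rw [Finset.prod_smul, map_smul, smul_eq_mul, Finset.prod_mul_distrib, prod_X_pow_eq, coordFun,
    Module.Basis.constr_basis]
  rfl

theorem coordFun_chebT {n : ℕ} (α β : Fin n → ℕ) :
    coordFun α (chebT β) = if β = α then 1 else 0 := by
  rw [chebT, coordFun_prod]
  simp_rw [← chebBasisOne_apply, Module.Basis.coord_apply, Module.Basis.repr_self,
    Finsupp.single_apply]
  split_ifs with h
  · subst h; simp
  · obtain ⟨i, hi⟩ := Function.ne_iff.mp h
    exact Finset.prod_eq_zero (Finset.mem_univ i) (if_neg hi)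

theorem chebT_linearIndependent (n : ℕ) :
    LinearIndependent ℝ (chebT : (Fin n → ℕ) → MvPolynomial (Fin n) ℝ) := by
  rw [linearIndependent_iff']
  intro s g hg α hα
  have := congrArg (coordFun α) hg
  simpa [coordFun_chebT, hα] using this

theorem chebT_span (n : ℕ) :
    ⊤ ≤ Submodule.span ℝ (Set.range (chebT : (Fin n → ℕ) → MvPolynomial (Fin n) ℝ)) := by
  rw [← (MvPolynomial.basisMonomials (Fin n) ℝ).span_eq, Submodule.span_le]
  rintro _ ⟨β, rfl⟩
  have h := prod_X_pow_eq (β : Fin n → ℕ)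
  rw [Finsupp.equivFunOnFinite_symm_coe] at h
  rw [← h]
  have h1 : ∀ i, (X i : MvPolynomial (Fin n) ℝ) ^ β i =
      ∑ k ∈ (chebBasisOne.repr (Polynomial.X ^ β i)).support,
        chebBasisOne.repr (Polynomial.X ^ β i) k •
          Polynomial.aeval (X i : MvPolynomial (Fin n) ℝ)
            (Polynomial.Chebyshev.T ℝ (k : ℤ)) := fun i => by
    have := congrArg (Polynomial.aeval (X i : MvPolynomial (Fin n) ℝ))
      (chebBasisOne.linearCombination_repr (Polynomial.X ^ β i))
    rw [Finsupp.linearCombination_apply, Finsupp.sum, map_sum] at this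
    simpa [chebBasisOne_apply] using this.symm
  simp_rw [h1]
  rw [Finset.prod_univ_sum]
  refine Submodule.sum_mem _ fun α _ => ?_
  rw [Finset.prod_smul]
  exact Submodule.smul_mem _ _ (Submodule.subset_span ⟨α, rfl⟩)

/-- The Chebyshev basis `(T_α)` of `ℝ[x₁,…,xₙ]`. -/
def chebBasis (n : ℕ) : Module.Basis (Fin n → ℕ) ℝ (MvPolynomial (Fin n) ℝ) :=
  Module.Basis.mk (chebT_linearIndependent n) (chebT_span n)

theorem chebBasis_apply {n : ℕ} (α : Fin n → ℕ) : chebBasis n α = chebT α := by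
  simp [chebBasis]

/-- `‖f‖_{1,T}`: the sum of the absolute values of the coefficients of `f` in the basis `(T_α)`. -/
def chebNorm {n : ℕ} (f : MvPolynomial (Fin n) ℝ) : ℝ :=
  ∑ α ∈ ((chebBasis n).repr f).support, |(chebBasis n).repr f α|

/-! ## Truncated pre-orderings and the hierarchy of lower bounds -/

/-- The truncated pre-ordering `𝒯(g₁,…,gₘ)_r`: sums `∑_I σ_I ∏_{i ∈ I} g_i` over all subsets `I` of
the index set, with sums of squares `σ_I` and every summand of degree at most `r`. -/
def truncPreordering {n : ℕ} {ι : Type} [Fintype ι] (g : ι → MvPolynomial (Fin n) ℝ) (r : ℕ) :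
    Set (MvPolynomial (Fin n) ℝ) :=
  {p | ∃ σ : Finset ι → MvPolynomial (Fin n) ℝ,
    (∀ I, IsSumSq (σ I)) ∧ (∀ I, (σ I * ∏ i ∈ I, g i).totalDegree ≤ r) ∧
      p = ∑ I, σ I * ∏ i ∈ I, g i}

/-- The `2n` polynomials `1 - x_i` and `1 + x_i` describing the hypercube. -/
def boxGen (n : ℕ) : Fin n ⊕ Fin n → MvPolynomial (Fin n) ℝ :=
  Sum.elim (fun i => 1 - X i) (fun i => 1 + X i)

/-- `𝒯(1 ± x₁, …, 1 ± xₙ)_r`. -/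
def boxPreordering (n r : ℕ) : Set (MvPolynomial (Fin n) ℝ) := truncPreordering (boxGen n) r

/-- `f_min`, the minimum of `f` over `[-1,1]ⁿ`. -/
def fmin {n : ℕ} (f : MvPolynomial (Fin n) ℝ) : ℝ := sInf ((fun x => eval x f) '' cube n)

/-- The infimum defining `fmin` is attained. -/
theorem fmin_isLeast {n : ℕ} (f : MvPolynomial (Fin n) ℝ) :
    IsLeast ((fun x => eval x f) '' cube n) (fmin f) := by
  refine IsCompact.isLeast_sInf ?_ ?_
  · exact isCompact_Icc.image (MvPolynomial.continuous_eval f)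
  · exact Set.Nonempty.image _ (Set.nonempty_Icc.mpr fun _ => by norm_num)

/-- `f̂_(r)`, the supremum of the `λ` with `f - λ ∈ 𝒯(1 ± x₁, …, 1 ± xₙ)_r`, in the extended reals
(so that it is `-∞` if there is no such `λ`). -/
def lowerBound {n : ℕ} (f : MvPolynomial (Fin n) ℝ) (r : ℕ) : EReal :=
  sSup ((fun l : ℝ => (l : EReal)) '' {l | f - C l ∈ boxPreordering n r})

/-! ## Kernels and the quantity `Θ` -/

/-- The measure `dμ = dx / (π √(1 - x²))` on `[-1,1]`. -/
def chebMeasureOne : MeasureTheory.Measure ℝ :=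
  ENNReal.ofReal Real.pi⁻¹ • Polynomial.Chebyshev.measureT

/-- The measure `dμ = ∏ dx_i / (π √(1 - x_i²))` on `[-1,1]ⁿ`. -/
def chebMeasure (n : ℕ) : MeasureTheory.Measure (Fin n → ℝ) :=
  MeasureTheory.Measure.pi fun _ => chebMeasureOne

/-- `K_r(x,y) = ∑_{|α| ≤ r} λ_α T̂_α(x) T̂_α(y)`. -/
def kernel {n : ℕ} (r : ℕ) (l : (Fin n → ℕ) → ℝ) (x y : Fin n → ℝ) : ℝ :=
  ∑ α ∈ multiIndices n r, l α * normTMulti α x * normTMulti α y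

/-- The convolution operator `f ↦ ∫ f(y) K_r(·,y) dμ(y)`. -/
def conv {n : ℕ} (r : ℕ) (l : (Fin n → ℕ) → ℝ) (f : MvPolynomial (Fin n) ℝ) (x : Fin n → ℝ) : ℝ :=
  ∫ y, eval y f * kernel r l x y ∂(chebMeasure n)

/-- Feasible coefficient families: `λ_α ∈ [0,1]`, `λ_0 = 1`, no terms of degree above `r`, and the
convolution operator maps each polynomial of degree at most `d` that is nonnegative on the hypercube
to (the function of) an element of `𝒯(1 ± x₁, …, 1 ± xₙ)_r`. -/
structure IsFeasible {n : ℕ} (d r : ℕ) (l : (Fin n → ℕ) → ℝ) : Prop where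
  mem_Icc : ∀ α, l α ∈ Set.Icc (0 : ℝ) 1
  zero_eq : l 0 = 1
  eq_zero : ∀ α, r < ∑ i, α i → l α = 0
  conv_mem : ∀ f : MvPolynomial (Fin n) ℝ, f.totalDegree ≤ d → (∀ x ∈ cube n, 0 ≤ eval x f) →
    ∃ p ∈ boxPreordering n r, ∀ x, eval x p = conv r l f x

/-- `max_{|α| ≤ d} |1 - λ_α|`. -/
def maxDev {n : ℕ} (d : ℕ) (l : (Fin n → ℕ) → ℝ) : ℝ :=
  (multiIndices n d).sup' ⟨0, zero_mem_multiIndices n d⟩ fun α => |1 - l α|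

/-- `Θ^r_{n,d}`, as an infimum in the extended reals. -/
def Theta (n d r : ℕ) : EReal :=
  sInf ((fun l => (maxDev d l : EReal)) '' {l : (Fin n → ℕ) → ℝ | IsFeasible d r l})

/-! ## Jackson kernels -/

/-- The coefficients of the univariate Jackson kernel of degree `r`, extended by `1` at `k = 0` and by
`0` for `k > r`. -/
def jacksonCoef (r k : ℕ) : ℝ :=
  if k = 0 then 1
  else if k ≤ r then
    1 / ((r : ℝ) + 2) * (((r : ℝ) + 2 - k) * Real.cos (k * (Real.pi / (r + 2))) +
      Real.sin (k * (Real.pi / (r + 2))) / Real.sin (Real.pi / (r + 2)) *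
        Real.cos (Real.pi / (r + 2)))
  else 0

/-- The univariate Jackson kernel `1 + ∑_{k=1}^r λ_k^r T̂_k(x) T̂_k(y)`. -/
def jacksonKernel (r : ℕ) (x y : ℝ) : ℝ :=
  1 + ∑ k ∈ Finset.Icc 1 r, jacksonCoef r k * normT k x * normT k y

/-- The product coefficients `λ_α^r = ∏ λ_{α_i}^r`. -/
def jacksonCoefMulti {n : ℕ} (r : ℕ) (α : Fin n → ℕ) : ℝ := ∏ i, jacksonCoef r (α i)

end HypercubeHierarchy

end

/-! The Jackson coefficients are the autocorrelations of `a_j = sin((j+1)θ)`, `θ = π/(r+2)`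
(`jacksonCoef_eq_sum`). Hence the kernel at `(cos φ, cos ψ)` is a positive multiple of `∑∑ a_i a_j
cos((j-i)φ) cos((j-i)ψ)`, and the addition formulas split this into four squares of cosine or sine
sums in `φ` with frequencies `j - r/2`. Such squares are polynomials in `cos φ` of the form square
times `1`, `1 ± x` or `1 - x²`, of degree at most `r`. So for fixed `y` the univariate kernel lies
in the pre-ordering of level `r` (`exists_eval_eq_jacksonKernel`), and the product kernel in that of
level `rn`.

Gauss–Chebyshev cubature turns the convolution of a nonnegative `f` into a finite nonnegative
combination of kernels at nodes, which gives feasibility. Taylor bounds give `1 - λ_k ≤ (kθ)²`, and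
a union bound passes to products.

For the hierarchy, with `ε = π²d²/(r+2)²`, `f - f_min + ε‖f‖` is the convolution of `f - f_min`,
plus `∑ (1-λ_α)(|f_α| + f_α T_α)`, plus a nonnegative constant; the middle terms are covered by `1 ±
T_α` having certificates of degree `|α|`. -/

noncomputable section

namespace HypercubeHierarchy

open MvPolynomial

/-! ### Arithmetic of truncated pre-orderings. -/

section Preordering

variable {n : ℕ} {ι : Type} [Fintype ι] {g : ι → MvPolynomial (Fin n) ℝ} {r s : ℕ}

theorem mul_prod_mem_truncPreordering {σ : MvPolynomial (Fin n) ℝ} (hσ : IsSumSq σ)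
    (I : Finset ι) (h : (σ * ∏ i ∈ I, g i).totalDegree ≤ r) :
    σ * ∏ i ∈ I, g i ∈ truncPreordering g r := by
  classical
  refine ⟨Pi.single I σ, fun J => ?_, fun J => ?_, ?_⟩
  · rcases eq_or_ne J I with rfl | hJ
    · simpa using hσ
    · simp [hJ, IsSumSq.zero]
  · rcases eq_or_ne J I with rfl | hJ
    · simpa using h
    · simp [hJ]
  · rw [Finset.sum_eq_single I]
    · simp
    · intro J _ hJ; simp [hJ]
    · simp

theorem zero_mem_truncPreordering : (0 : MvPolynomial (Fin n) ℝ) ∈ truncPreordering g r :=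
  ⟨0, fun _ => IsSumSq.zero, by simp, by simp⟩

theorem add_mem_truncPreordering {p q : MvPolynomial (Fin n) ℝ}
    (hp : p ∈ truncPreordering g r) (hq : q ∈ truncPreordering g r) :
    p + q ∈ truncPreordering g r := by
  obtain ⟨σ, h1, h2, rfl⟩ := hp
  obtain ⟨τ, k1, k2, rfl⟩ := hq
  refine ⟨σ + τ, fun I => (h1 I).add (k1 I), fun I => ?_, ?_⟩
  · rw [Pi.add_apply, add_mul]
    exact (totalDegree_add _ _).trans (max_le (h2 I) (k2 I))
  · simp [add_mul, Finset.sum_add_distrib]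

theorem sum_mem_truncPreordering {κ : Type*} {t : Finset κ} {p : κ → MvPolynomial (Fin n) ℝ}
    (h : ∀ k ∈ t, p k ∈ truncPreordering g r) : ∑ k ∈ t, p k ∈ truncPreordering g r :=
  Finset.sum_induction _ _ (fun _ _ => add_mem_truncPreordering) zero_mem_truncPreordering h

theorem truncPreordering_mono (h : r ≤ s) : truncPreordering g r ⊆ truncPreordering g s := by
  rintro _ ⟨σ, h1, h2, rfl⟩
  exact ⟨σ, h1, fun I => (h2 I).trans h, rfl⟩

/-- Generators common to `I` and `J` occur twice, so they form a square that joins the multiplier;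
the symmetric difference of `I` and `J` remains. -/
theorem mul_mem_truncPreordering {p q : MvPolynomial (Fin n) ℝ}
    (hp : p ∈ truncPreordering g r) (hq : q ∈ truncPreordering g s) :
    p * q ∈ truncPreordering g (r + s) := by
  classical
  obtain ⟨σ, h1, h2, rfl⟩ := hp
  obtain ⟨τ, k1, k2, rfl⟩ := hq
  rw [Finset.sum_mul_sum]
  refine sum_mem_truncPreordering fun I _ => sum_mem_truncPreordering fun J _ => ?_
  have key : σ I * (∏ i ∈ I, g i) * (τ J * ∏ i ∈ J, g i) =
      (σ I * τ J * ((∏ i ∈ I ∩ J, g i) * ∏ i ∈ I ∩ J, g i)) * ∏ i ∈ (I \ J) ∪ (J \ I), g i := by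
    rw [Finset.prod_union (Finset.disjoint_left.mpr fun i hi hj => by
      simp only [Finset.mem_sdiff] at hi hj; exact hi.2 hj.1),
      ← Finset.prod_inter_mul_prod_sdiff I J g, ← Finset.prod_inter_mul_prod_sdiff J I g,
      Finset.inter_comm J I]
    ring
  have hdeg : (σ I * (∏ i ∈ I, g i) * (τ J * ∏ i ∈ J, g i)).totalDegree ≤ r + s :=
    (totalDegree_mul _ _).trans (add_le_add (h2 I) (k2 J))
  rw [key] at hdeg ⊢
  exact mul_prod_mem_truncPreordering (((h1 I).mul (k1 J)).mul (IsSumSq.mul_self _)) _ hdeg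

theorem isSumSq_mem_truncPreordering {σ : MvPolynomial (Fin n) ℝ} (hσ : IsSumSq σ)
    (h : σ.totalDegree ≤ r) : σ ∈ truncPreordering g r := by
  have := mul_prod_mem_truncPreordering (g := g) hσ ∅ (r := r) (by simpa using h)
  simpa using this

theorem C_mem_truncPreordering {c : ℝ} (hc : 0 ≤ c) :
    (C c : MvPolynomial (Fin n) ℝ) ∈ truncPreordering g r := by
  refine isSumSq_mem_truncPreordering ?_ (by simp)
  rw [← Real.mul_self_sqrt hc, C_mul]
  exact IsSumSq.mul_self _

theorem C_mul_mem_truncPreordering {c : ℝ} (hc : 0 ≤ c) {p : MvPolynomial (Fin n) ℝ}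
    (hp : p ∈ truncPreordering g r) : C c * p ∈ truncPreordering g r := by
  have := mul_mem_truncPreordering (C_mem_truncPreordering (r := 0) (g := g) hc) hp
  rwa [zero_add] at this

theorem gen_mem_truncPreordering (i : ι) (h : (g i).totalDegree ≤ r) :
    g i ∈ truncPreordering g r := by
  have := mul_prod_mem_truncPreordering (g := g) (r := r) IsSumSq.one {i} (by simpa using h)
  simpa using this

theorem prod_mem_truncPreordering {κ : Type*} (t : Finset κ) (p : κ → MvPolynomial (Fin n) ℝ)
    (e : κ → ℕ) (h : ∀ k ∈ t, p k ∈ truncPreordering g (e k)) :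
    ∏ k ∈ t, p k ∈ truncPreordering g (∑ k ∈ t, e k) := by
  classical
  induction t using Finset.induction_on with
  | empty => simpa using C_mem_truncPreordering (g := g) (r := 0) zero_le_one
  | insert a t ha ih =>
    rw [Finset.prod_insert ha, Finset.sum_insert ha]
    exact mul_mem_truncPreordering (h a (Finset.mem_insert_self a t))
      (ih fun k hk => h k (Finset.mem_insert_of_mem hk))

/-- If `1 ± a k` lie in the truncated pre-orderings of levels `e k`, then `1 ± ∏ a k` lie in that of
level `∑ e k`. -/
theorem one_add_prod_mem_truncPreordering {κ : Type*} (t : Finset κ)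
    (a : κ → MvPolynomial (Fin n) ℝ) (e : κ → ℕ)
    (h : ∀ k ∈ t, 1 + a k ∈ truncPreordering g (e k) ∧ 1 - a k ∈ truncPreordering g (e k)) :
    1 + ∏ k ∈ t, a k ∈ truncPreordering g (∑ k ∈ t, e k) ∧
      1 - ∏ k ∈ t, a k ∈ truncPreordering g (∑ k ∈ t, e k) := by
  classical
  induction t using Finset.induction_on with
  | empty =>
    refine ⟨?_, by simpa using zero_mem_truncPreordering⟩
    have := C_mem_truncPreordering (g := g) (r := 0) zero_le_two
    rw [map_ofNat] at this
    simpa [one_add_one_eq_two] using this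
  | insert k t hk ih =>
    rw [Finset.prod_insert hk, Finset.sum_insert hk]
    obtain ⟨h1, h2⟩ := h k (Finset.mem_insert_self k t)
    obtain ⟨h3, h4⟩ := ih fun k hk => h k (Finset.mem_insert_of_mem hk)
    have hhalf : (C (1 / 2 : ℝ) : MvPolynomial (Fin n) ℝ) * 2 = 1 := by
      rw [← map_ofNat C 2, ← C_mul]; norm_num
    constructor
    -- `1 + ab = ½((1+a)(1+b) + (1-a)(1-b))` and `1 - ab = ½((1+a)(1-b) + (1-a)(1+b))`.
    · have := C_mul_mem_truncPreordering (c := 1 / 2) (by norm_num) (add_mem_truncPreordering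
        (mul_mem_truncPreordering h1 h3) (mul_mem_truncPreordering h2 h4))
      convert this using 1
      linear_combination (-(1 + a k * ∏ k ∈ t, a k)) * hhalf
    · have := C_mul_mem_truncPreordering (c := 1 / 2) (by norm_num) (add_mem_truncPreordering
        (mul_mem_truncPreordering h1 h4) (mul_mem_truncPreordering h2 h3))
      convert this using 1
      linear_combination (-(1 - a k * ∏ k ∈ t, a k)) * hhalf

end Preordering

/-! ### Univariate certificates from trigonometric squares. -/

section OneVariable

variable {n : ℕ}

theorem totalDegree_aeval_X_le (i : Fin n) (q : Polynomial ℝ) :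
    (Polynomial.aeval (X i : MvPolynomial (Fin n) ℝ) q).totalDegree ≤ q.natDegree := by
  rw [Polynomial.aeval_eq_sum_range]
  refine totalDegree_finsetSum_le fun k hk => (totalDegree_smul_le _ _).trans ?_
  rw [totalDegree_X_pow]
  exact Nat.lt_succ_iff.mp (Finset.mem_range.mp hk)

theorem one_sub_X_mem_boxPreordering (i : Fin n) :
    (1 - X i : MvPolynomial (Fin n) ℝ) ∈ boxPreordering n 1 :=
  gen_mem_truncPreordering (g := boxGen n) (Sum.inl i)
    ((totalDegree_sub _ _).trans (by simp))

theorem one_add_X_mem_boxPreordering (i : Fin n) :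
    (1 + X i : MvPolynomial (Fin n) ℝ) ∈ boxPreordering n 1 :=
  gen_mem_truncPreordering (g := boxGen n) (Sum.inr i)
    ((totalDegree_add _ _).trans (by simp))

theorem aeval_sq_mem_boxPreordering (i : Fin n) (q : Polynomial ℝ) :
    Polynomial.aeval (X i : MvPolynomial (Fin n) ℝ) (q ^ 2) ∈
      boxPreordering n (2 * q.natDegree) := by
  refine isSumSq_mem_truncPreordering ?_ ?_
  · rw [pow_two, map_mul]; exact IsSumSq.mul_self _
  · exact (totalDegree_aeval_X_le i _).trans Polynomial.natDegree_pow_le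

theorem aeval_one_add_X_mul_sq_mem_boxPreordering (i : Fin n) (q : Polynomial ℝ) :
    Polynomial.aeval (X i : MvPolynomial (Fin n) ℝ) ((1 + Polynomial.X) * q ^ 2) ∈
      boxPreordering n (1 + 2 * q.natDegree) := by
  rw [map_mul, map_add, map_one, Polynomial.aeval_X]
  exact mul_mem_truncPreordering (one_add_X_mem_boxPreordering i) (aeval_sq_mem_boxPreordering i q)

theorem aeval_one_sub_X_mul_sq_mem_boxPreordering (i : Fin n) (q : Polynomial ℝ) :
    Polynomial.aeval (X i : MvPolynomial (Fin n) ℝ) ((1 - Polynomial.X) * q ^ 2) ∈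
      boxPreordering n (1 + 2 * q.natDegree) := by
  rw [map_mul, map_sub, map_one, Polynomial.aeval_X]
  exact mul_mem_truncPreordering (one_sub_X_mem_boxPreordering i) (aeval_sq_mem_boxPreordering i q)

theorem aeval_one_sub_X_sq_mul_sq_mem_boxPreordering (i : Fin n) (q : Polynomial ℝ) :
    Polynomial.aeval (X i : MvPolynomial (Fin n) ℝ) ((1 - Polynomial.X ^ 2) * q ^ 2) ∈
      boxPreordering n (2 + 2 * q.natDegree) := by
  rw [show (1 - Polynomial.X ^ 2 : Polynomial ℝ) * q ^ 2 =
    (1 + Polynomial.X) * ((1 - Polynomial.X) * q ^ 2) by ring, map_mul, map_add, map_one,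
    Polynomial.aeval_X, show 2 + 2 * q.natDegree = 1 + (1 + 2 * q.natDegree) by ring]
  exact mul_mem_truncPreordering (one_add_X_mem_boxPreordering i)
    (aeval_one_sub_X_mul_sq_mem_boxPreordering i q)

/-- `(U_m - U_{m-1})(cos φ) cos (φ/2) = cos ((m + 1/2) φ)`. -/
theorem eval_U_sub_U_mul_cos_half (m : ℤ) {φ : ℝ} (hφ : φ ∈ Set.Ioo 0 Real.pi) :
    (Polynomial.Chebyshev.U ℝ m - Polynomial.Chebyshev.U ℝ (m - 1)).eval (Real.cos φ) *
      Real.cos (φ / 2) = Real.cos ((m + 1 / 2) * φ) := by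
  have hs : Real.sin (φ / 2) ≠ 0 :=
    (Real.sin_pos_of_pos_of_lt_pi (by linarith [hφ.1]) (by linarith [hφ.1, hφ.2])).ne'
  have h1 := Polynomial.Chebyshev.U_real_cos φ m
  have h2 := Polynomial.Chebyshev.U_real_cos φ (m - 1)
  have h3 : Real.sin φ = 2 * Real.sin (φ / 2) * Real.cos (φ / 2) := by
    rw [← Real.sin_two_mul]; ring_nf
  -- Expanding `sin((m+1)φ)` and `sin(mφ)` about the midpoint `(m+1/2)φ` makes the sine parts cancel
  -- in the difference.
  have h4 : Real.sin ((m + 1) * φ) = Real.sin ((m + 1 / 2) * φ) * Real.cos (φ / 2) +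
      Real.cos ((m + 1 / 2) * φ) * Real.sin (φ / 2) := by
    rw [← Real.sin_add]; ring_nf
  have h5 : Real.sin (((m - 1 : ℤ) + 1) * φ) = Real.sin ((m + 1 / 2) * φ) * Real.cos (φ / 2) -
      Real.cos ((m + 1 / 2) * φ) * Real.sin (φ / 2) := by
    rw [← Real.sin_sub]; push_cast; ring_nf
  rw [h4, h3] at h1
  rw [h5, h3] at h2
  rw [Polynomial.eval_sub]
  apply mul_left_cancel₀ hs
  linear_combination (1 / 2) * h1 - (1 / 2) * h2

/-- `(U_m + U_{m-1})(cos φ) sin (φ/2) = sin ((m + 1/2) φ)`. -/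
theorem eval_U_add_U_mul_sin_half (m : ℤ) {φ : ℝ} (hφ : φ ∈ Set.Ioo 0 Real.pi) :
    (Polynomial.Chebyshev.U ℝ m + Polynomial.Chebyshev.U ℝ (m - 1)).eval (Real.cos φ) *
      Real.sin (φ / 2) = Real.sin ((m + 1 / 2) * φ) := by
  have hs : Real.cos (φ / 2) ≠ 0 :=
    (Real.cos_pos_of_mem_Ioo ⟨by linarith [hφ.1, Real.pi_pos], by linarith [hφ.1, hφ.2, Real.pi_pos]⟩).ne'
  have h1 := Polynomial.Chebyshev.U_real_cos φ m
  have h2 := Polynomial.Chebyshev.U_real_cos φ (m - 1)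
  have h3 : Real.sin φ = 2 * Real.sin (φ / 2) * Real.cos (φ / 2) := by
    rw [← Real.sin_two_mul]; ring_nf
  have h4 : Real.sin ((m + 1) * φ) = Real.sin ((m + 1 / 2) * φ) * Real.cos (φ / 2) +
      Real.cos ((m + 1 / 2) * φ) * Real.sin (φ / 2) := by
    rw [← Real.sin_add]; ring_nf
  have h5 : Real.sin (((m - 1 : ℤ) + 1) * φ) = Real.sin ((m + 1 / 2) * φ) * Real.cos (φ / 2) -
      Real.cos ((m + 1 / 2) * φ) * Real.sin (φ / 2) := by
    rw [← Real.sin_sub]; push_cast; ring_nf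
  rw [h4, h3] at h1
  rw [h5, h3] at h2
  rw [Polynomial.eval_add]
  apply mul_left_cancel₀ hs
  linear_combination (1 / 2) * h1 + (1 / 2) * h2

theorem natDegree_sum_C_mul_le (t : Finset ℕ) (c : ℕ → ℝ) (q : ℕ → Polynomial ℝ) {D : ℕ}
    (h : ∀ j ∈ t, (q j).natDegree ≤ D) :
    (∑ j ∈ t, Polynomial.C (c j) * q j).natDegree ≤ D :=
  Polynomial.natDegree_sum_le_of_forall_le _ _ fun j hj =>
    (Polynomial.natDegree_C_mul_le _ _).trans (h j hj)

/-- Squares of cosine sums with frequencies `j - r/2` come from the level-`r` pre-ordering of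
`[-1,1]`. -/
theorem exists_eval_cos_eq_sq_cos (n r : ℕ) (c : ℕ → ℝ) :
    ∃ P : Polynomial ℝ,
      (∀ i, Polynomial.aeval (X i : MvPolynomial (Fin n) ℝ) P ∈ boxPreordering n r) ∧
      ∀ φ ∈ Set.Ioo 0 Real.pi, P.eval (Real.cos φ) =
        (∑ j ∈ Finset.range (r + 1), c j * Real.cos ((j - r / 2) * φ)) ^ 2 := by
  obtain ⟨s, rfl | rfl⟩ := r.even_or_odd'
  -- Even level: the frequencies are the integers `j - s`, and `T` has degree `|j - s| ≤ s`.
  · let q : Polynomial ℝ := ∑ j ∈ Finset.range (2 * s + 1),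
      Polynomial.C (c j) * Polynomial.Chebyshev.T ℝ ((j : ℤ) - s)
    have hq : q.natDegree ≤ s := natDegree_sum_C_mul_le _ _ _ fun j hj => by
      rw [Finset.mem_range] at hj
      rw [Polynomial.Chebyshev.natDegree_T]; omega
    refine ⟨q ^ 2, fun i => truncPreordering_mono (by omega) (aeval_sq_mem_boxPreordering i q),
      fun φ _ => ?_⟩
    simp only [q, Polynomial.eval_pow, Polynomial.eval_finsetSum, Polynomial.eval_mul,
      Polynomial.eval_C, Polynomial.Chebyshev.T_real_cos]
    congr! 5
    push_cast; ring
  -- Odd level: the frequencies are half-integers, so `cos(φ/2)` factors out; its square `(1 + cos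
  -- φ)/2` supplies the generator `1 + x`.
  · let q : Polynomial ℝ := ∑ j ∈ Finset.range (2 * s + 1 + 1),
      Polynomial.C (c j) * (Polynomial.Chebyshev.U ℝ ((j : ℤ) - s - 1) -
        Polynomial.Chebyshev.U ℝ ((j : ℤ) - s - 1 - 1))
    have hq : q.natDegree ≤ s := natDegree_sum_C_mul_le _ _ _ fun j hj => by
      rw [Finset.mem_range] at hj
      refine (Polynomial.natDegree_sub_le _ _).trans ?_
      rw [Polynomial.Chebyshev.natDegree_U, Polynomial.Chebyshev.natDegree_U]; omega
    refine ⟨Polynomial.C (1 / 2) * ((1 + Polynomial.X) * q ^ 2), fun i => ?_, fun φ hφ => ?_⟩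
    · rw [map_mul, Polynomial.aeval_C]
      exact C_mul_mem_truncPreordering (by norm_num) (truncPreordering_mono (by omega)
        (aeval_one_add_X_mul_sq_mem_boxPreordering i q))
    · have h1 : q.eval (Real.cos φ) * Real.cos (φ / 2) = ∑ j ∈ Finset.range (2 * s + 1 + 1),
          c j * Real.cos ((j - (2 * s + 1 : ℕ) / 2) * φ) := by
        simp only [q, Polynomial.eval_finsetSum, Polynomial.eval_mul, Polynomial.eval_C,
          Finset.sum_mul, mul_assoc]
        refine Finset.sum_congr rfl fun j _ => ?_
        rw [eval_U_sub_U_mul_cos_half _ hφ]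
        push_cast; ring_nf
      rw [← h1, mul_pow, Real.cos_sq]
      simp only [Polynomial.eval_mul, Polynomial.eval_C, Polynomial.eval_add, Polynomial.eval_one,
        Polynomial.eval_X, Polynomial.eval_pow]
      ring_nf

/-- Squares of sine sums with frequencies `j - r/2` come from the level-`r` pre-ordering of
`[-1,1]`. -/
theorem exists_eval_cos_eq_sq_sin (n r : ℕ) (c : ℕ → ℝ) :
    ∃ P : Polynomial ℝ,
      (∀ i, Polynomial.aeval (X i : MvPolynomial (Fin n) ℝ) P ∈ boxPreordering n r) ∧
      ∀ φ ∈ Set.Ioo 0 Real.pi, P.eval (Real.cos φ) =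
        (∑ j ∈ Finset.range (r + 1), c j * Real.sin ((j - r / 2) * φ)) ^ 2 := by
  obtain ⟨s, rfl | rfl⟩ := r.even_or_odd'
  -- At level `0` the sine sum vanishes, and the factor `1 - x²` used below would not fit.
  · rcases Nat.eq_zero_or_pos s with rfl | hs
    · exact ⟨0, fun i => by rw [map_zero]; exact zero_mem_truncPreordering, fun φ _ => by simp⟩
    -- Here `sin φ` factors out, leaving degree `s - 1`; with `sin² φ = 1 - x²` the total is `2 +
    -- 2(s-1) = 2s`.
    let q : Polynomial ℝ := ∑ j ∈ Finset.range (2 * s + 1),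
      Polynomial.C (c j) * Polynomial.Chebyshev.U ℝ ((j : ℤ) - s - 1)
    have hq : q.natDegree ≤ s - 1 := natDegree_sum_C_mul_le _ _ _ fun j hj => by
      rw [Finset.mem_range] at hj
      rw [Polynomial.Chebyshev.natDegree_U]; omega
    refine ⟨(1 - Polynomial.X ^ 2) * q ^ 2, fun i => truncPreordering_mono (by omega)
      (aeval_one_sub_X_sq_mul_sq_mem_boxPreordering i q), fun φ _ => ?_⟩
    have h1 : q.eval (Real.cos φ) * Real.sin φ = ∑ j ∈ Finset.range (2 * s + 1),
        c j * Real.sin ((j - (2 * s : ℕ) / 2) * φ) := by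
      simp only [q, Polynomial.eval_finsetSum, Polynomial.eval_mul, Polynomial.eval_C,
        Finset.sum_mul, mul_assoc]
      refine Finset.sum_congr rfl fun j _ => ?_
      rw [Polynomial.Chebyshev.U_real_cos]
      push_cast; ring_nf
    rw [← h1, mul_pow, Real.sin_sq]
    simp only [Polynomial.eval_mul, Polynomial.eval_sub, Polynomial.eval_one,
      Polynomial.eval_X, Polynomial.eval_pow]
    ring_nf
  · let q : Polynomial ℝ := ∑ j ∈ Finset.range (2 * s + 1 + 1),
      Polynomial.C (c j) * (Polynomial.Chebyshev.U ℝ ((j : ℤ) - s - 1) +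
        Polynomial.Chebyshev.U ℝ ((j : ℤ) - s - 1 - 1))
    have hq : q.natDegree ≤ s := natDegree_sum_C_mul_le _ _ _ fun j hj => by
      rw [Finset.mem_range] at hj
      refine (Polynomial.natDegree_add_le _ _).trans ?_
      rw [Polynomial.Chebyshev.natDegree_U, Polynomial.Chebyshev.natDegree_U]; omega
    refine ⟨Polynomial.C (1 / 2) * ((1 - Polynomial.X) * q ^ 2), fun i => ?_, fun φ hφ => ?_⟩
    · rw [map_mul, Polynomial.aeval_C]
      exact C_mul_mem_truncPreordering (by norm_num) (truncPreordering_mono (by omega)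
        (aeval_one_sub_X_mul_sq_mem_boxPreordering i q))
    · have h1 : q.eval (Real.cos φ) * Real.sin (φ / 2) = ∑ j ∈ Finset.range (2 * s + 1 + 1),
          c j * Real.sin ((j - (2 * s + 1 : ℕ) / 2) * φ) := by
        simp only [q, Polynomial.eval_finsetSum, Polynomial.eval_mul, Polynomial.eval_C,
          Finset.sum_mul, mul_assoc]
        refine Finset.sum_congr rfl fun j _ => ?_
        rw [eval_U_add_U_mul_sin_half _ hφ]
        push_cast; ring_nf
      rw [← h1, mul_pow, Real.sin_sq, Real.cos_sq]
      simp only [Polynomial.eval_mul, Polynomial.eval_C, Polynomial.eval_sub, Polynomial.eval_one,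
        Polynomial.eval_X, Polynomial.eval_pow]
      ring_nf

/-- Two real polynomials that agree at `cos φ` for all `φ ∈ (0, π)` are equal. -/
theorem polynomial_eq_of_eval_cos_eq {p q : Polynomial ℝ}
    (h : ∀ φ ∈ Set.Ioo 0 Real.pi, p.eval (Real.cos φ) = q.eval (Real.cos φ)) : p = q := by
  refine Polynomial.eq_of_infinite_eval_eq p q (Set.Infinite.mono ?_
    ((Set.Ioo_infinite Real.pi_pos).image
      (Real.injOn_cos.mono Set.Ioo_subset_Icc_self)))
  rintro _ ⟨φ, hφ, rfl⟩
  exact h φ hφ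

/-- From `1 + cos kφ = 2 cos²(kφ/2)`: the coefficient sequence `Pi.single k 1` selects the frequency
`k - k/2 = k/2`. The companion with `1 - T_k` uses the sine square. -/
theorem one_add_aeval_T_mem_boxPreordering (k : ℕ) (i : Fin n) :
    1 + Polynomial.aeval (X i : MvPolynomial (Fin n) ℝ) (Polynomial.Chebyshev.T ℝ (k : ℤ)) ∈
      boxPreordering n k := by
  obtain ⟨P, hP, hPe⟩ := exists_eval_cos_eq_sq_cos n k (Pi.single k 1)
  have h : 1 + Polynomial.Chebyshev.T ℝ (k : ℤ) = Polynomial.C 2 * P := by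
    refine polynomial_eq_of_eval_cos_eq fun φ hφ => ?_
    rw [Polynomial.eval_mul, hPe φ hφ, Finset.sum_eq_single k
      (fun j _ hj => by simp [hj]) (by simp), Pi.single_eq_same, one_mul, Real.cos_sq]
    simp only [Polynomial.eval_add, Polynomial.eval_one, Polynomial.eval_C,
      Polynomial.Chebyshev.T_real_cos]
    push_cast; ring_nf
  have h2 := congrArg (Polynomial.aeval (X i : MvPolynomial (Fin n) ℝ)) h
  rw [map_add, map_one, map_mul, Polynomial.aeval_C] at h2
  rw [h2]
  exact C_mul_mem_truncPreordering (by norm_num) (hP i)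

theorem one_sub_aeval_T_mem_boxPreordering (k : ℕ) (i : Fin n) :
    1 - Polynomial.aeval (X i : MvPolynomial (Fin n) ℝ) (Polynomial.Chebyshev.T ℝ (k : ℤ)) ∈
      boxPreordering n k := by
  obtain ⟨P, hP, hPe⟩ := exists_eval_cos_eq_sq_sin n k (Pi.single k 1)
  have h : 1 - Polynomial.Chebyshev.T ℝ (k : ℤ) = Polynomial.C 2 * P := by
    refine polynomial_eq_of_eval_cos_eq fun φ hφ => ?_
    rw [Polynomial.eval_mul, hPe φ hφ, Finset.sum_eq_single k
      (fun j _ hj => by simp [hj]) (by simp), Pi.single_eq_same, one_mul, Real.sin_sq, Real.cos_sq]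
    simp only [Polynomial.eval_sub, Polynomial.eval_one, Polynomial.eval_C,
      Polynomial.Chebyshev.T_real_cos]
    push_cast; ring_nf
  have h2 := congrArg (Polynomial.aeval (X i : MvPolynomial (Fin n) ℝ)) h
  rw [map_sub, map_one, map_mul, Polynomial.aeval_C] at h2
  rw [h2]
  exact C_mul_mem_truncPreordering (by norm_num) (hP i)

theorem one_add_chebT_mem_boxPreordering (α : Fin n → ℕ) :
    1 + chebT α ∈ boxPreordering n (∑ i, α i) ∧ 1 - chebT α ∈ boxPreordering n (∑ i, α i) :=
  one_add_prod_mem_truncPreordering _ _ _ fun i _ =>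
    ⟨one_add_aeval_T_mem_boxPreordering _ i, one_sub_aeval_T_mem_boxPreordering _ i⟩

theorem totalDegree_chebT_le (α : Fin n → ℕ) : (chebT α).totalDegree ≤ ∑ i, α i :=
  (totalDegree_finsetProd _ _).trans (Finset.sum_le_sum fun i _ =>
    (totalDegree_aeval_X_le i _).trans (by simp [Polynomial.Chebyshev.natDegree_T]))

end OneVariable

/-! ### Jackson coefficients: autocorrelation, size, and the kernel as a sum of squares. -/

section Jackson

/-- By product-to-sum, each term gives a constant `cos kθ` and a cosine in arithmetic progression;
the latter telescope after multiplication by `sin θ`. -/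
theorem sum_sin_mul_sin (k m : ℕ) (θ : ℝ) :
    2 * Real.sin θ * ∑ j ∈ Finset.range m, Real.sin ((j + 1) * θ) * Real.sin ((j + k + 1) * θ) =
      m * Real.sin θ * Real.cos (k * θ) -
        (Real.sin ((2 * m + k + 1) * θ) - Real.sin ((k + 1) * θ)) / 2 := by
  induction m with
  | zero => simp
  | succ m ih =>
    rw [Finset.sum_range_succ, mul_add, ih]
    have h1 : Real.cos (k * θ) = Real.cos ((m + k + 1) * θ - (m + 1) * θ) := by ring_nf
    have h2 : Real.sin ((2 * (m + 1 : ℕ) + k + 1) * θ) =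
        Real.sin (((m + k + 1) * θ + (m + 1) * θ) + θ) := by push_cast; ring_nf
    have h3 : Real.sin ((2 * m + k + 1) * θ) =
        Real.sin (((m + k + 1) * θ + (m + 1) * θ) - θ) := by ring_nf
    rw [h2, h3, h1, Real.sin_add, Real.sin_sub, Real.cos_sub, Real.cos_add]
    push_cast
    ring

theorem pi_div_add_two_pos (r : ℕ) : 0 < Real.pi / ((r : ℝ) + 2) := by positivity

theorem pi_div_add_two_le (r : ℕ) : Real.pi / ((r : ℝ) + 2) ≤ Real.pi / 2 :=
  div_le_div_of_nonneg_left Real.pi_nonneg two_pos (by linarith [r.cast_nonneg (α := ℝ)])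

theorem sin_pi_div_add_two_pos (r : ℕ) : 0 < Real.sin (Real.pi / ((r : ℝ) + 2)) :=
  Real.sin_pos_of_pos_of_lt_pi (pi_div_add_two_pos r)
    (by linarith [pi_div_add_two_le r, Real.pi_pos])

/-- The generating sequence of the Jackson kernel. -/
def jacksonSeq (r j : ℕ) : ℝ := Real.sin ((j + 1) * (Real.pi / (r + 2)))

theorem jacksonSeq_nonneg {r j : ℕ} (h : j ≤ r) : 0 ≤ jacksonSeq r j := by
  refine Real.sin_nonneg_of_nonneg_of_le_pi (by positivity) ?_
  rw [← mul_div_assoc, div_le_iff₀ (by positivity), mul_comm]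
  have : (j : ℝ) ≤ r := by exact_mod_cast h
  exact mul_le_mul_of_nonneg_left (by linarith) Real.pi_nonneg

/-- The Jackson coefficients are the autocorrelations of `jacksonSeq`. -/
theorem jacksonCoef_eq_sum {r k : ℕ} (hk : k ≤ r) :
    jacksonCoef r k = 2 / ((r : ℝ) + 2) *
      ∑ j ∈ Finset.range (r + 1 - k), jacksonSeq r j * jacksonSeq r (j + k) := by
  have hs := sin_pi_div_add_two_pos r
  have hr : ((r : ℝ) + 2) ≠ 0 := by positivity
  have h1 : jacksonCoef r k = 1 / ((r : ℝ) + 2) * (((r : ℝ) + 2 - k) *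
      Real.cos (k * (Real.pi / (r + 2))) + Real.sin (k * (Real.pi / (r + 2))) /
        Real.sin (Real.pi / (r + 2)) * Real.cos (Real.pi / (r + 2))) := by
    rw [jacksonCoef]
    split_ifs with h
    · subst h; simp [hr]
    · rfl
  have h2 := sum_sin_mul_sin k (r + 1 - k) (Real.pi / ((r : ℝ) + 2))
  -- The angle is `2(r+2)θ - (k+1)θ = 2π - (k+1)θ`, so the two boundary sines of the telescoped sum
  -- combine.
  have h3 : Real.sin ((2 * (r + 1 - k : ℕ) + k + 1) * (Real.pi / ((r : ℝ) + 2))) =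
      -Real.sin ((k + 1) * (Real.pi / ((r : ℝ) + 2))) := by
    rw [← Real.sin_two_pi_sub]
    congr 1
    rw [Nat.cast_sub (by omega)]
    push_cast
    field_simp
    ring
  rw [h3, Nat.cast_sub (by omega), add_mul, one_mul, Real.sin_add] at h2
  have h4 : ∑ j ∈ Finset.range (r + 1 - k), jacksonSeq r j * jacksonSeq r (j + k) =
      ∑ j ∈ Finset.range (r + 1 - k), Real.sin ((j + 1) * (Real.pi / (r + 2))) *
        Real.sin ((j + k + 1) * (Real.pi / (r + 2))) := by
    simp [jacksonSeq]
  rw [h1, h4]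
  push_cast at h2
  clear h1 h3 h4
  generalize Real.pi / ((r : ℝ) + 2) = θ at h2 hs ⊢
  generalize ∑ j ∈ Finset.range (r + 1 - k),
    Real.sin ((j + 1) * θ) * Real.sin ((j + k + 1) * θ) = S at h2 ⊢
  field_simp
  linear_combination -h2

theorem jacksonCoef_zero (r : ℕ) : jacksonCoef r 0 = 1 := by simp [jacksonCoef]

theorem jacksonCoef_of_lt {r k : ℕ} (h : r < k) : jacksonCoef r k = 0 := by
  rw [jacksonCoef, if_neg (by omega), if_neg (by omega)]

theorem jacksonCoef_nonneg (r k : ℕ) : 0 ≤ jacksonCoef r k := by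
  rcases le_or_gt k r with hk | hk
  · rw [jacksonCoef_eq_sum hk]
    refine mul_nonneg (by positivity) (Finset.sum_nonneg fun j hj => ?_)
    rw [Finset.mem_range] at hj
    exact mul_nonneg (jacksonSeq_nonneg (by omega)) (jacksonSeq_nonneg (by omega))
  · rw [jacksonCoef_of_lt hk]

/-- `λ_0 = 1` is a scaled squared norm of `jacksonSeq`, and `λ_k` is the equally scaled inner
product with a shift; AM–GM bounds it termwise. -/
theorem jacksonCoef_le_one (r k : ℕ) : jacksonCoef r k ≤ 1 := by
  rcases le_or_gt k r with hk | hk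
  · rw [← jacksonCoef_zero r, jacksonCoef_eq_sum hk, jacksonCoef_eq_sum (Nat.zero_le r)]
    refine mul_le_mul_of_nonneg_left ?_ (by positivity)
    have h1 : ∑ j ∈ Finset.range (r + 1 - k), jacksonSeq r j ^ 2 ≤
        ∑ j ∈ Finset.range (r + 1), jacksonSeq r j ^ 2 :=
      Finset.sum_le_sum_of_subset_of_nonneg (Finset.range_subset_range.mpr (by omega))
        fun _ _ _ => sq_nonneg _
    have h2 : ∑ j ∈ Finset.range (r + 1 - k), jacksonSeq r (j + k) ^ 2 ≤
        ∑ j ∈ Finset.range (r + 1), jacksonSeq r j ^ 2 := by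
      rw [← Finset.sum_range_add_sum_Ico _ (show k ≤ r + 1 by omega), Finset.sum_Ico_eq_sum_range]
      simp only [add_comm k]
      exact le_add_of_nonneg_left (Finset.sum_nonneg fun _ _ => sq_nonneg _)
    have h3 : ∑ j ∈ Finset.range (r + 1 - k), jacksonSeq r j * jacksonSeq r (j + k) ≤
        ∑ j ∈ Finset.range (r + 1 - k),
          (jacksonSeq r j ^ 2 + jacksonSeq r (j + k) ^ 2) / 2 :=
      Finset.sum_le_sum fun j _ => by
        linarith [two_mul_le_add_sq (jacksonSeq r j) (jacksonSeq r (j + k))]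
    rw [← Finset.sum_div, Finset.sum_add_distrib] at h3
    simp only [add_zero, Nat.sub_zero, ← pow_two]
    linarith
  · rw [jacksonCoef_of_lt hk]; exact zero_le_one

/-- `λ_k` is an average with weights `r+2-k` and `k` of `cos kθ` and `sin kθ cos θ / (k sin θ)`.
Both are at least `1 - (kθ)²` by Taylor bounds, since `kθ < 1`. -/
theorem one_sub_jacksonCoef_le {r k : ℕ} (hk : Real.pi * (k : ℝ) < (r : ℝ) + 2) :
    1 - jacksonCoef r k ≤ (k : ℝ) ^ 2 * (Real.pi ^ 2 / ((r : ℝ) + 2) ^ 2) := by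
  rcases Nat.eq_zero_or_pos k with rfl | hk0
  · simp [jacksonCoef_zero]
  have hN : (0 : ℝ) < (r : ℝ) + 2 := by positivity
  have hk1 : (1 : ℝ) ≤ k := by exact_mod_cast hk0
  have hkr : k ≤ r := by
    have h1 : 3 * (k : ℝ) < (r : ℝ) + 2 :=
      lt_of_le_of_lt (mul_le_mul_of_nonneg_right Real.pi_gt_three.le (by positivity)) hk
    have h2 : 3 * k < r + 2 := by exact_mod_cast h1
    omega
  set θ := Real.pi / ((r : ℝ) + 2) with hθ
  have hθ0 : 0 < θ := pi_div_add_two_pos r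
  have hkθ : k * θ < 1 := by
    rw [hθ, ← mul_div_assoc, div_lt_one hN, mul_comm]; exact hk
  have hθ1 : θ < 1 := lt_of_le_of_lt (le_mul_of_one_le_left hθ0.le hk1) hkθ
  have hs : 0 < Real.sin θ := sin_pi_div_add_two_pos r
  have hkθ0 : 0 < k * θ := by positivity
  have h1 : k * θ - (k * θ) ^ 3 / 6 ≤ Real.sin (k * θ) := Real.sin_ge_sub_cube hkθ0.le
  have h2 : 1 - θ ^ 2 / 2 ≤ Real.cos θ := Real.one_sub_sq_div_two_le_cos
  have h3 : 1 - (k * θ) ^ 2 / 2 ≤ Real.cos (k * θ) := Real.one_sub_sq_div_two_le_cos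
  have h4 : Real.sin θ ≤ θ := Real.sin_le hθ0.le
  have hsq : (k * θ) ^ 2 ≤ 1 := pow_le_one₀ hkθ0.le hkθ.le
  have hsq1 : θ ^ 2 ≤ 1 := pow_le_one₀ hθ0.le hθ1.le
  have hsq2 : θ ^ 2 ≤ (k * θ) ^ 2 :=
    pow_le_pow_left₀ hθ0.le (le_mul_of_one_le_left hθ0.le hk1) 2
  have h5 : k * (1 - (k * θ) ^ 2 / 6) * (1 - θ ^ 2 / 2) ≤
      Real.sin (k * θ) / Real.sin θ * Real.cos θ := by
    refine mul_le_mul ?_ h2 (by linarith) (div_nonneg (le_trans ?_ h1) hs.le)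
    · rw [le_div_iff₀ hs]
      calc k * (1 - (k * θ) ^ 2 / 6) * Real.sin θ ≤ k * (1 - (k * θ) ^ 2 / 6) * θ :=
            mul_le_mul_of_nonneg_left h4 (mul_nonneg (by positivity) (by linarith))
        _ = k * θ - (k * θ) ^ 3 / 6 := by ring
        _ ≤ _ := h1
    · rw [show k * θ - (k * θ) ^ 3 / 6 = k * θ * (1 - (k * θ) ^ 2 / 6) by ring]
      exact mul_nonneg hkθ0.le (by linarith)
  -- As `θ ≤ kθ`, the losses `1/6` and `1/2` add up to less than one multiple of `(kθ)²`.
  have h6 : k * (1 - (k * θ) ^ 2) ≤ k * (1 - (k * θ) ^ 2 / 6) * (1 - θ ^ 2 / 2) := by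
    rw [mul_assoc]
    refine mul_le_mul_of_nonneg_left ?_ (by positivity)
    nlinarith [mul_nonneg (sq_nonneg (k * θ)) (sq_nonneg θ)]
  have hkr' : (k : ℝ) ≤ r := by exact_mod_cast hkr
  have h7 : ((r : ℝ) + 2 - k) * (1 - (k * θ) ^ 2) ≤ ((r : ℝ) + 2 - k) * Real.cos (k * θ) :=
    mul_le_mul_of_nonneg_left (by linarith [sq_nonneg (k * θ)]) (by linarith)
  have h8 : (k : ℝ) ^ 2 * (Real.pi ^ 2 / ((r : ℝ) + 2) ^ 2) = (k * θ) ^ 2 := by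
    rw [hθ, mul_pow, div_pow]
  rw [h8, jacksonCoef, if_neg hk0.ne', if_pos hkr, sub_le_comm, one_div, ← div_eq_inv_mul,
    le_div_iff₀ hN]
  linarith

theorem jacksonCoefMulti_mem_Icc {n : ℕ} (r : ℕ) (α : Fin n → ℕ) :
    jacksonCoefMulti r α ∈ Set.Icc (0 : ℝ) 1 :=
  ⟨Finset.prod_nonneg fun _ _ => jacksonCoef_nonneg _ _,
    Finset.prod_le_one (fun _ _ => jacksonCoef_nonneg _ _) fun _ _ => jacksonCoef_le_one _ _⟩

theorem jacksonCoefMulti_zero {n : ℕ} (r : ℕ) : jacksonCoefMulti r (0 : Fin n → ℕ) = 1 := by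
  simp [jacksonCoefMulti, jacksonCoef_zero]

theorem jacksonCoefMulti_of_lt {n r : ℕ} {α : Fin n → ℕ} {i : Fin n} (h : r < α i) :
    jacksonCoefMulti r α = 0 :=
  Finset.prod_eq_zero (Finset.mem_univ i) (jacksonCoef_of_lt h)

/-- The union bound for independent events of probabilities `1 - u k`. -/
theorem one_sub_prod_le_sum_one_sub {κ : Type*} (t : Finset κ) (u : κ → ℝ)
    (h0 : ∀ k ∈ t, 0 ≤ u k) (h1 : ∀ k ∈ t, u k ≤ 1) :
    1 - ∏ k ∈ t, u k ≤ ∑ k ∈ t, (1 - u k) := by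
  classical
  induction t using Finset.induction_on with
  | empty => simp
  | insert a t ha ih =>
    rw [Finset.prod_insert ha, Finset.sum_insert ha]
    have ih' := ih (fun k hk => h0 k (Finset.mem_insert_of_mem hk))
      fun k hk => h1 k (Finset.mem_insert_of_mem hk)
    have hP : ∏ k ∈ t, u k ≤ 1 := Finset.prod_le_one
      (fun k hk => h0 k (Finset.mem_insert_of_mem hk))
      fun k hk => h1 k (Finset.mem_insert_of_mem hk)
    have ha1 := h1 a (Finset.mem_insert_self a t)
    nlinarith [mul_nonneg (sub_nonneg.mpr ha1) (sub_nonneg.mpr hP)]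

theorem one_sub_jacksonCoefMulti_le {n r d : ℕ} (hd : Real.pi * (d : ℝ) < (r : ℝ) + 2)
    {α : Fin n → ℕ} (hα : ∑ i, α i ≤ d) :
    1 - jacksonCoefMulti r α ≤ Real.pi ^ 2 * (d : ℝ) ^ 2 / ((r : ℝ) + 2) ^ 2 := by
  have hle : ∀ i, α i ≤ d := fun i =>
    (Finset.single_le_sum (f := α) (fun j _ => Nat.zero_le _) (Finset.mem_univ i)).trans hα
  calc 1 - jacksonCoefMulti r α ≤ ∑ i, (1 - jacksonCoef r (α i)) :=
        one_sub_prod_le_sum_one_sub _ _ (fun _ _ => jacksonCoef_nonneg _ _)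
          fun _ _ => jacksonCoef_le_one _ _
    _ ≤ ∑ i, (α i : ℝ) ^ 2 * (Real.pi ^ 2 / ((r : ℝ) + 2) ^ 2) :=
        Finset.sum_le_sum fun i _ => one_sub_jacksonCoef_le (lt_of_le_of_lt
          (mul_le_mul_of_nonneg_left (by exact_mod_cast hle i) Real.pi_nonneg) hd)
    _ = (∑ i, (α i : ℝ) ^ 2) * (Real.pi ^ 2 / ((r : ℝ) + 2) ^ 2) := by rw [Finset.sum_mul]
    _ ≤ (d : ℝ) ^ 2 * (Real.pi ^ 2 / ((r : ℝ) + 2) ^ 2) := by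
        refine mul_le_mul_of_nonneg_right ?_ (by positivity)
        -- This inequality keeps the bound free of `n`.
        calc ∑ i, (α i : ℝ) ^ 2 ≤ (∑ i, (α i : ℝ)) ^ 2 :=
              Finset.sum_sq_le_sq_sum_of_nonneg fun i _ => by positivity
          _ ≤ (d : ℝ) ^ 2 := by
              gcongr
              exact_mod_cast hα
    _ = _ := by ring

/-- A symmetric double sum, summed along its diagonals. -/
theorem sum_range_sum_range_eq_of_symm (h : ℕ → ℕ → ℝ) (hh : ∀ i j, h i j = h j i) (m : ℕ) :
    ∑ i ∈ Finset.range m, ∑ j ∈ Finset.range m, h i j =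
      ∑ k ∈ Finset.range m, (if k = 0 then 1 else 2) *
        ∑ j ∈ Finset.range (m - k), h j (j + k) := by
  induction m with
  | zero => simp
  | succ m ih =>
    -- Passing from `m` to `m + 1` adds one entry `h (m - k) m` to each diagonal `k`.
    have h1 : ∑ k ∈ Finset.range (m + 1), (if k = 0 then (1 : ℝ) else 2) *
          ∑ j ∈ Finset.range (m + 1 - k), h j (j + k) =
        ∑ k ∈ Finset.range (m + 1), ((if k = 0 then (1 : ℝ) else 2) *
          ∑ j ∈ Finset.range (m - k), h j (j + k) + (if k = 0 then 1 else 2) * h (m - k) m) := by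
      refine Finset.sum_congr rfl fun k hk => ?_
      rw [Finset.mem_range] at hk
      rw [show m + 1 - k = (m - k) + 1 by omega, Finset.sum_range_succ, mul_add,
        show m - k + k = m by omega]
    have h2 : ∑ k ∈ Finset.range (m + 1), (if k = 0 then (1 : ℝ) else 2) * h (m - k) m =
        2 * ∑ j ∈ Finset.range m, h j m + h m m := by
      rw [Finset.sum_range_succ']
      simp only [Nat.succ_ne_zero, if_false, if_true, Nat.sub_zero, one_mul]
      rw [← Finset.mul_sum, ← Finset.sum_range_reflect (fun j => h j m) m]
      congr 3
      funext k
      congr 1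
      omega
    have h3 : ∑ k ∈ Finset.range (m + 1), (if k = 0 then (1 : ℝ) else 2) *
          ∑ j ∈ Finset.range (m - k), h j (j + k) =
        ∑ i ∈ Finset.range m, ∑ j ∈ Finset.range m, h i j := by
      rw [Finset.sum_range_succ, ih]; simp
    rw [h1, Finset.sum_add_distrib, h2, h3, Finset.sum_range_succ _ m]
    simp only [Finset.sum_range_succ _ m, Finset.sum_add_distrib, hh m]
    ring

/-- Each `cos((j-i)χ)` is a sum of two products separating `i` from `j`, for any shift `s`;
multiplying the versions for `φ` and `ψ` gives four squares. The shift `s = r/2` later centres the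
frequencies, which halves the degree of each factor. -/
theorem sum_sum_cos_sub_mul_cos_sub (m : ℕ) (a : ℕ → ℝ) (s φ ψ : ℝ) :
    ∑ i ∈ Finset.range m, ∑ j ∈ Finset.range m,
        a i * a j * (Real.cos (((j : ℝ) - i) * φ) * Real.cos (((j : ℝ) - i) * ψ)) =
      (∑ j ∈ Finset.range m, a j * Real.cos ((j - s) * ψ) * Real.cos ((j - s) * φ)) ^ 2 +
      (∑ j ∈ Finset.range m, a j * Real.sin ((j - s) * ψ) * Real.cos ((j - s) * φ)) ^ 2 +
      (∑ j ∈ Finset.range m, a j * Real.cos ((j - s) * ψ) * Real.sin ((j - s) * φ)) ^ 2 +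
      (∑ j ∈ Finset.range m, a j * Real.sin ((j - s) * ψ) * Real.sin ((j - s) * φ)) ^ 2 := by
  simp only [pow_two, Finset.sum_mul_sum, ← Finset.sum_add_distrib]
  refine Finset.sum_congr rfl fun i _ => Finset.sum_congr rfl fun j _ => ?_
  have h : ∀ χ : ℝ, Real.cos (((j : ℝ) - i) * χ) = Real.cos ((j - s) * χ) * Real.cos ((i - s) * χ) +
      Real.sin ((j - s) * χ) * Real.sin ((i - s) * χ) := fun χ => by
    rw [← Real.cos_sub]; ring_nf
  rw [h, h]
  ring

theorem normT_mul_normT (k : ℕ) (x y : ℝ) :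
    normT k x * normT k y = (if k = 0 then 1 else 2) *
      ((Polynomial.Chebyshev.T ℝ (k : ℤ)).eval x * (Polynomial.Chebyshev.T ℝ (k : ℤ)).eval y) := by
  rw [normT, normT, mul_mul_mul_comm]
  split_ifs <;> simp

theorem jacksonKernel_eq_sum_range (r : ℕ) (x y : ℝ) :
    jacksonKernel r x y =
      ∑ k ∈ Finset.range (r + 1), jacksonCoef r k * (normT k x * normT k y) := by
  rw [jacksonKernel, Finset.range_eq_Ico, Finset.sum_eq_sum_Ico_succ_bot (by omega)]
  congr 1
  · simp [jacksonCoef_zero, normT]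
  · refine Finset.sum_congr (by ext; simp) fun k _ => by ring

/-- The factor `√2 · √2 = 2` for `k ≥ 1` counts the two diagonals `j - i = ±k`. -/
theorem jacksonKernel_cos_cos (r : ℕ) (φ ψ : ℝ) :
    jacksonKernel r (Real.cos φ) (Real.cos ψ) = 2 / ((r : ℝ) + 2) *
      ∑ i ∈ Finset.range (r + 1), ∑ j ∈ Finset.range (r + 1), jacksonSeq r i * jacksonSeq r j *
        (Real.cos (((j : ℝ) - i) * φ) * Real.cos (((j : ℝ) - i) * ψ)) := by
  rw [sum_range_sum_range_eq_of_symm, jacksonKernel_eq_sum_range, Finset.mul_sum]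
  · refine Finset.sum_congr rfl fun k hk => ?_
    rw [jacksonCoef_eq_sum (Nat.lt_succ_iff.mp (Finset.mem_range.mp hk)), normT_mul_normT]
    simp only [Polynomial.Chebyshev.T_real_cos, Nat.cast_add, add_sub_cancel_left,
      ← Finset.sum_mul]
    push_cast
    ring
  · intro i j
    rw [← neg_sub (i : ℝ) j, neg_mul, neg_mul, Real.cos_neg, Real.cos_neg]
    ring

/-- For fixed `y ∈ [-1,1]` the Jackson kernel of degree `r` is a polynomial in the level-`r`
pre-ordering of `[-1,1]`. -/
theorem exists_eval_eq_jacksonKernel (n r : ℕ) {y : ℝ} (hy : y ∈ Set.Icc (-1 : ℝ) 1) :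
    ∃ P : Polynomial ℝ,
      (∀ i, Polynomial.aeval (X i : MvPolynomial (Fin n) ℝ) P ∈ boxPreordering n r) ∧
      ∀ x, P.eval x = jacksonKernel r x y := by
  obtain ⟨ψ, rfl⟩ : ∃ ψ, Real.cos ψ = y := ⟨Real.arccos y, Real.cos_arccos hy.1 hy.2⟩
  let Q : Polynomial ℝ := ∑ k ∈ Finset.range (r + 1), Polynomial.C
    (jacksonCoef r k * ((if k = 0 then 1 else 2) *
      (Polynomial.Chebyshev.T ℝ (k : ℤ)).eval (Real.cos ψ))) * Polynomial.Chebyshev.T ℝ (k : ℤ)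
  have hQ : ∀ x, Q.eval x = jacksonKernel r x (Real.cos ψ) := fun x => by
    rw [jacksonKernel_eq_sum_range, Polynomial.eval_finsetSum]
    refine Finset.sum_congr rfl fun k _ => ?_
    rw [normT_mul_normT, Polynomial.eval_mul, Polynomial.eval_C]
    ring
  obtain ⟨P₁, h₁, e₁⟩ := exists_eval_cos_eq_sq_cos n r
    fun j => jacksonSeq r j * Real.cos ((j - r / 2) * ψ)
  obtain ⟨P₂, h₂, e₂⟩ := exists_eval_cos_eq_sq_cos n r
    fun j => jacksonSeq r j * Real.sin ((j - r / 2) * ψ)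
  obtain ⟨P₃, h₃, e₃⟩ := exists_eval_cos_eq_sq_sin n r
    fun j => jacksonSeq r j * Real.cos ((j - r / 2) * ψ)
  obtain ⟨P₄, h₄, e₄⟩ := exists_eval_cos_eq_sq_sin n r
    fun j => jacksonSeq r j * Real.sin ((j - r / 2) * ψ)
  -- The squares are known only at `x = cos φ`, `0 < φ < π`, but these infinitely many points
  -- determine a polynomial.
  have hQP : Q = Polynomial.C (2 / ((r : ℝ) + 2)) * (P₁ + P₂ + P₃ + P₄) :=
    polynomial_eq_of_eval_cos_eq fun φ hφ => by
      rw [hQ, jacksonKernel_cos_cos, sum_sum_cos_sub_mul_cos_sub _ _ (r / 2),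
        Polynomial.eval_mul, Polynomial.eval_C, Polynomial.eval_add, Polynomial.eval_add,
        Polynomial.eval_add, e₁ φ hφ, e₂ φ hφ, e₃ φ hφ, e₄ φ hφ]
  refine ⟨Q, fun i => ?_, hQ⟩
  rw [hQP, map_mul, Polynomial.aeval_C, map_add, map_add, map_add]
  exact C_mul_mem_truncPreordering (by positivity) (add_mem_truncPreordering
    (add_mem_truncPreordering (add_mem_truncPreordering (h₁ i) (h₂ i)) (h₃ i)) (h₄ i))

end Jackson

/-! ### Gauss–Chebyshev cubature and the convolution operator. -/

section Measure

open MeasureTheory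

variable {n : ℕ}

instance isFiniteMeasure_chebMeasureOne : IsFiniteMeasure chebMeasureOne := by
  have h : IsFiniteMeasure Polynomial.Chebyshev.measureT := by
    have := Polynomial.Chebyshev.integrable_measureT (f := fun _ => (1 : ℝ)) continuousOn_const
    simpa using integrable_const_iff.mp this
  exact Measure.smul_finite _ ENNReal.ofReal_ne_top

theorem integral_chebMeasureOne (f : ℝ → ℝ) :
    ∫ t, f t ∂chebMeasureOne = Real.pi⁻¹ * ∫ t, f t ∂Polynomial.Chebyshev.measureT := by
  rw [chebMeasureOne, integral_smul_measure, ENNReal.toReal_ofReal (by positivity), smul_eq_mul]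

theorem integrable_chebMeasureOne {f : ℝ → ℝ} (hf : Continuous f) :
    Integrable f chebMeasureOne :=
  (Polynomial.Chebyshev.integrable_measureT hf.continuousOn).smul_measure ENNReal.ofReal_ne_top

theorem integrable_eval_chebMeasure (f : MvPolynomial (Fin n) ℝ) :
    Integrable (fun y => eval y f) (chebMeasure n) := by
  simp only [eval_eq']
  refine integrable_finsetSum _ fun β _ => Integrable.const_mul ?_ _
  exact Integrable.fintype_prod (f := fun i t => t ^ β i)
    fun i => integrable_chebMeasureOne (by fun_prop)

/-- The Chebyshev nodes. -/
def chebNode (M i : ℕ) : ℝ := Real.cos ((2 * i + 1) / (2 * M) * Real.pi)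

theorem integral_eval_chebMeasureOne {M : ℕ} {P : Polynomial ℝ} (hP : P.natDegree < 2 * M) :
    ∫ t, P.eval t ∂chebMeasureOne =
      ∑ i ∈ Finset.range M, (M : ℝ)⁻¹ * P.eval (chebNode M i) := by
  have hdeg : P.degree < 2 * M :=
    lt_of_le_of_lt Polynomial.degree_le_natDegree (by exact_mod_cast hP)
  rw [integral_chebMeasureOne, Polynomial.Chebyshev.integral_eq_sumZeroes (by omega) hdeg,
    Polynomial.Chebyshev.sumZeroes, ← Finset.mul_sum]
  simp only [chebNode]
  field_simp

/-- Gauss–Chebyshev cubature on the hypercube. -/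
theorem integral_eval_chebMeasure {M : ℕ} {f : MvPolynomial (Fin n) ℝ}
    (hf : f.totalDegree < 2 * M) :
    ∫ y, eval y f ∂(chebMeasure n) =
      ∑ ν ∈ Fintype.piFinset (fun _ : Fin n => Finset.range M),
        ((M : ℝ)⁻¹) ^ n * eval (fun i => chebNode M (ν i)) f := by
  simp only [eval_eq']
  rw [integral_finsetSum]
  · simp only [Finset.mul_sum]
    rw [Finset.sum_comm]
    refine Finset.sum_congr rfl fun β hβ => ?_
    rw [integral_const_mul, chebMeasure,
      integral_fintype_prod_eq_prod (fun (i : Fin n) (t : ℝ) => t ^ β i)]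
    have h1 : ∀ i, ∫ t, t ^ β i ∂chebMeasureOne =
        ∑ k ∈ Finset.range M, (M : ℝ)⁻¹ * chebNode M k ^ β i := fun i => by
      -- The univariate rule is exact below degree `2M`, and each exponent is at most the total
      -- degree.
      have h2 : (Polynomial.X ^ β i : Polynomial ℝ).natDegree < 2 * M := by
        rw [Polynomial.natDegree_X_pow]
        refine lt_of_le_of_lt ?_ hf
        have := le_totalDegree hβ
        rw [Finsupp.sum_fintype _ _ fun _ => rfl] at this
        exact (Finset.single_le_sum (f := fun i => β i) (fun _ _ => Nat.zero_le _)
          (Finset.mem_univ i)).trans this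
      simpa using integral_eval_chebMeasureOne h2
    simp only [h1]
    rw [Finset.prod_univ_sum, Finset.mul_sum]
    refine Finset.sum_congr rfl fun ν _ => ?_
    rw [Finset.prod_mul_distrib, Finset.prod_const, Finset.card_univ, Fintype.card_fin]
    ring
  · refine fun β _ => Integrable.const_mul ?_ _
    exact Integrable.fintype_prod (f := fun i t => t ^ β i)
      fun i => integrable_chebMeasureOne (by fun_prop)

/-- The normalizing constant of `T̂ₖ`. -/
def normTConst (k : ℕ) : ℝ := if k = 0 then 1 else Real.sqrt 2

theorem normTConst_ne_zero (k : ℕ) : normTConst k ≠ 0 := by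
  rw [normTConst]; split_ifs <;> simp

theorem eval_chebT (α : Fin n → ℕ) (x : Fin n → ℝ) :
    eval x (chebT α) = ∏ i, (Polynomial.Chebyshev.T ℝ (α i : ℤ)).eval (x i) := by
  rw [chebT, map_prod]
  refine Finset.prod_congr rfl fun i _ => ?_
  rw [Polynomial.aeval_def, Polynomial.hom_eval₂, eval_X, Polynomial.eval]
  congr 1
  ext; simp

theorem normTMulti_eq (α : Fin n → ℕ) (x : Fin n → ℝ) :
    normTMulti α x = (∏ i, normTConst (α i)) * eval x (chebT α) := by
  rw [eval_chebT, ← Finset.prod_mul_distrib]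
  rfl

/-- The kernel as a polynomial in its second argument. -/
def kernelPoly (r : ℕ) (l : (Fin n → ℕ) → ℝ) (x : Fin n → ℝ) : MvPolynomial (Fin n) ℝ :=
  ∑ α ∈ multiIndices n r, C (l α * normTMulti α x * ∏ i, normTConst (α i)) * chebT α

theorem eval_kernelPoly (r : ℕ) (l : (Fin n → ℕ) → ℝ) (x y : Fin n → ℝ) :
    eval y (kernelPoly r l x) = kernel r l x y := by
  rw [kernelPoly, kernel, map_sum]
  refine Finset.sum_congr rfl fun α _ => ?_
  rw [map_mul, eval_C, normTMulti_eq α y]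
  ring

theorem totalDegree_kernelPoly_le (r : ℕ) (l : (Fin n → ℕ) → ℝ) (x : Fin n → ℝ) :
    (kernelPoly r l x).totalDegree ≤ r :=
  totalDegree_finsetSum_le fun α hα => (totalDegree_mul _ _).trans (by
    rw [totalDegree_C, zero_add]
    exact (totalDegree_chebT_le α).trans (mem_multiIndices.mp hα))

theorem conv_eq_integral_eval (r : ℕ) (l : (Fin n → ℕ) → ℝ) (f : MvPolynomial (Fin n) ℝ)
    (x : Fin n → ℝ) : conv r l f x = ∫ y, eval y (f * kernelPoly r l x) ∂(chebMeasure n) := by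
  simp only [map_mul, eval_kernelPoly]
  rfl

/-- Nodes and weights do not depend on `x`, so the image of `f` is a finite combination of the
functions `K(·, node)`. Membership in a pre-ordering then needs no limit argument. -/
theorem conv_eq_sum_chebNode {r d M : ℕ} (l : (Fin n → ℕ) → ℝ) {f : MvPolynomial (Fin n) ℝ}
    (hf : f.totalDegree ≤ d) (hM : d + r < 2 * M) (x : Fin n → ℝ) :
    conv r l f x = ∑ ν ∈ Fintype.piFinset (fun _ : Fin n => Finset.range M),
      ((M : ℝ)⁻¹) ^ n * (eval (fun i => chebNode M (ν i)) f *
        kernel r l x fun i => chebNode M (ν i)) := by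
  have hdeg : (f * kernelPoly r l x).totalDegree < 2 * M :=
    lt_of_le_of_lt ((totalDegree_mul _ _).trans
      (add_le_add hf (totalDegree_kernelPoly_le r l x))) hM
  rw [conv_eq_integral_eval, integral_eval_chebMeasure hdeg]
  simp only [map_mul, eval_kernelPoly]

theorem conv_sum {κ : Type*} (t : Finset κ) (r : ℕ) (l : (Fin n → ℕ) → ℝ) (c : κ → ℝ)
    (p : κ → MvPolynomial (Fin n) ℝ) (x : Fin n → ℝ) :
    conv r l (∑ k ∈ t, c k • p k) x = ∑ k ∈ t, c k * conv r l (p k) x := by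
  simp only [conv_eq_integral_eval, Finset.sum_mul, map_sum, smul_mul_assoc, smul_eval]
  rw [integral_finsetSum _ fun k _ => (integrable_eval_chebMeasure _).const_mul _]
  simp only [integral_const_mul]

/-- Only one factor is normalised, hence the inverse constant on the diagonal. -/
theorem integral_T_mul_normT (a b : ℕ) :
    ∫ t, (Polynomial.Chebyshev.T ℝ (b : ℤ)).eval t * normT a t ∂chebMeasureOne =
      if a = b then (normTConst b)⁻¹ else 0 := by
  have h : ∀ t, (Polynomial.Chebyshev.T ℝ (b : ℤ)).eval t * normT a t = normTConst a *
      ((Polynomial.Chebyshev.T ℝ (b : ℤ)).eval t * (Polynomial.Chebyshev.T ℝ (a : ℤ)).eval t) :=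
    fun t => by rw [normT, normTConst]; ring
  simp only [h]
  rw [integral_const_mul, integral_chebMeasureOne]
  split_ifs with hab
  · subst hab
    rcases Nat.eq_zero_or_pos a with rfl | ha
    · have := Polynomial.Chebyshev.integral_eval_T_real_mul_self_measureT_zero
      rw [Nat.cast_zero, this]
      simp [normTConst]
    · rw [Polynomial.Chebyshev.integral_T_real_mul_self_measureT_of_ne_zero ha.ne', normTConst,
        if_neg ha.ne']
      field_simp
      norm_num
  · rw [Polynomial.Chebyshev.integral_eval_T_real_mul_eval_T_real_measureT_of_ne (Ne.symm hab)]
    simp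

theorem integral_chebT_mul_normTMulti (α β : Fin n → ℕ) :
    ∫ y, eval y (chebT β) * normTMulti α y ∂(chebMeasure n) =
      if α = β then ∏ i, (normTConst (β i))⁻¹ else 0 := by
  simp only [eval_chebT, normTMulti, ← Finset.prod_mul_distrib]
  rw [chebMeasure, integral_fintype_prod_eq_prod (fun (i : Fin n) (t : ℝ) =>
    (Polynomial.Chebyshev.T ℝ (β i : ℤ)).eval t * normT (α i) t)]
  simp only [integral_T_mul_normT]
  split_ifs with h
  · subst h; simp
  · obtain ⟨i, hi⟩ := Function.ne_iff.mp h
    exact Finset.prod_eq_zero (Finset.mem_univ i) (if_neg hi)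

/-- The convolution operator is diagonal in the Chebyshev basis. -/
theorem conv_chebT {r : ℕ} (l : (Fin n → ℕ) → ℝ) {β : Fin n → ℕ} (hβ : ∑ i, β i ≤ r)
    (x : Fin n → ℝ) : conv r l (chebT β) x = l β * eval x (chebT β) := by
  have h : ∀ y, eval y (chebT β) * kernel r l x y = ∑ α ∈ multiIndices n r,
      l α * normTMulti α x * (eval y (chebT β) * normTMulti α y) := fun y => by
    rw [kernel, Finset.mul_sum]
    exact Finset.sum_congr rfl fun α _ => by ring
  have hint : ∀ α, Integrable (fun y => eval y (chebT β) * normTMulti α y) (chebMeasure n) :=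
    fun α => by
      have := (integrable_eval_chebMeasure (chebT β * chebT α)).const_mul
        (∏ i, normTConst (α i))
      refine this.congr (Filter.Eventually.of_forall fun y => ?_)
      simp only [normTMulti_eq, map_mul]
      ring
  rw [conv]
  simp only [h]
  rw [integral_finsetSum _ fun α _ => (hint α).const_mul _]
  simp only [integral_const_mul, integral_chebT_mul_normTMulti]
  rw [Finset.sum_eq_single β (fun α _ hα => by simp [hα])
    (fun hn => absurd (mem_multiIndices.mpr hβ) hn), if_pos rfl, normTMulti_eq,
    Finset.prod_inv_distrib]
  have : ∏ i, normTConst (β i) ≠ 0 := Finset.prod_ne_zero_iff.mpr fun i _ => normTConst_ne_zero _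
  field_simp

end Measure

/-! ### The Chebyshev expansion respects total degree. -/

section ChebyshevCoefficients

variable {n : ℕ}

theorem chebBasisOne_coord_X_pow {m k : ℕ} (h : m < k) :
    chebBasisOne.coord k (Polynomial.X ^ m) = 0 := by
  have hmem : (Polynomial.X ^ m : Polynomial ℝ) ∈ Polynomial.degreeLT ℝ k := by
    rw [Polynomial.mem_degreeLT, Polynomial.degree_X_pow]
    exact_mod_cast h
  rw [← Polynomial.Sequence.span_degreeLT chebSeq fun i _ => by
    rw [isUnit_iff_ne_zero, Polynomial.leadingCoeff_ne_zero]
    exact chebSeq.ne_zero i] at hmem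
  refine Submodule.span_induction (p := fun p _ => chebBasisOne.coord k p = 0) ?_ (map_zero _)
    (fun p q _ _ hp hq => by rw [map_add, hp, hq, add_zero])
    (fun c p _ hp => by rw [map_smul, hp, smul_zero]) hmem
  rintro _ ⟨j, hj, rfl⟩
  change chebBasisOne.coord k (Polynomial.Chebyshev.T ℝ (j : ℤ)) = 0
  rw [← chebBasisOne_apply, Module.Basis.coord_apply, Module.Basis.repr_self,
    Finsupp.single_eq_of_ne (ne_of_gt hj)]

theorem chebBasis_repr_eq_coordFun (f : MvPolynomial (Fin n) ℝ) (α : Fin n → ℕ) :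
    (chebBasis n).repr f α = coordFun α f := by
  have : (chebBasis n).coord α = coordFun α := by
    refine (chebBasis n).ext fun β => ?_
    rw [Module.Basis.coord_apply, Module.Basis.repr_self, chebBasis_apply, coordFun_chebT,
      Finsupp.single_apply]
  exact congrArg (fun φ => φ f) this

/-- If `|α| > deg f`, every monomial `β` of `f` has some `β i < α i`; the corresponding factor of
the product functional `coordFun` kills `X ^ β i`, a combination of `T_j` with `j < α i`. -/
theorem sum_le_totalDegree_of_mem_support {f : MvPolynomial (Fin n) ℝ} {α : Fin n → ℕ}
    (h : α ∈ ((chebBasis n).repr f).support) : ∑ i, α i ≤ f.totalDegree := by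
  rw [Finsupp.mem_support_iff, chebBasis_repr_eq_coordFun] at h
  by_contra! hlt
  apply h
  rw [f.as_sum, map_sum]
  refine Finset.sum_eq_zero fun β hβ => ?_
  have h1 : monomial β (coeff β f) = coeff β f • basisMonomials (Fin n) ℝ β := by
    rw [coe_basisMonomials, smul_monomial, smul_eq_mul, mul_one]
  have h2 : ∑ i, β i ≤ f.totalDegree := by
    have := le_totalDegree hβ
    rwa [Finsupp.sum_fintype _ _ fun _ => rfl] at this
  obtain ⟨i, hi⟩ : ∃ i, β i < α i := by
    by_contra! hle
    have := Finset.sum_le_sum fun i (_ : i ∈ Finset.univ) => hle i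
    omega
  rw [h1, map_smul, coordFun, Module.Basis.constr_basis,
    Finset.prod_eq_zero (Finset.mem_univ i) (chebBasisOne_coord_X_pow hi), smul_zero]

theorem sum_repr_smul_chebT (f : MvPolynomial (Fin n) ℝ) :
    ∑ α ∈ ((chebBasis n).repr f).support, (chebBasis n).repr f α • chebT α = f := by
  have := (chebBasis n).linearCombination_repr f
  simpa only [Finsupp.linearCombination_apply, Finsupp.sum, chebBasis_apply] using this

end ChebyshevCoefficients

/-! ### Feasibility of the product kernel and the error bound. -/

section Hierarchy

variable {n : ℕ}

/-- Expanding the product yields the box `α i ≤ r`, contained in `|α| ≤ rn`; outside the box the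
coefficients vanish. -/
theorem kernel_jacksonCoefMulti (r : ℕ) (x y : Fin n → ℝ) :
    kernel (r * n) (jacksonCoefMulti r) x y = ∏ i, jacksonKernel r (x i) (y i) := by
  simp only [jacksonKernel_eq_sum_range]
  rw [Finset.prod_univ_sum, kernel]
  symm
  have hterm : ∀ α : Fin n → ℕ, ∏ i, jacksonCoef r (α i) * (normT (α i) (x i) * normT (α i) (y i)) =
      jacksonCoefMulti r α * normTMulti α x * normTMulti α y := fun α => by
    rw [Finset.prod_mul_distrib, Finset.prod_mul_distrib, mul_assoc]
    rfl
  simp only [hterm]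
  refine Finset.sum_subset (fun α hα => ?_) fun α _ hα => ?_
  · rw [Fintype.mem_piFinset] at hα
    rw [mem_multiIndices]
    calc ∑ i, α i ≤ ∑ _i : Fin n, r :=
          Finset.sum_le_sum fun i _ => Nat.lt_succ_iff.mp (Finset.mem_range.mp (hα i))
      _ = r * n := by simp [mul_comm]
  · simp only [Fintype.mem_piFinset, Finset.mem_range, not_forall, not_lt] at hα
    obtain ⟨i, hi⟩ := hα
    rw [jacksonCoefMulti_of_lt (i := i) (by omega), zero_mul, zero_mul]

theorem chebNode_mem_Icc (M i : ℕ) : chebNode M i ∈ Set.Icc (-1 : ℝ) 1 := Real.cos_mem_Icc _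

theorem isFeasible_jacksonCoefMulti (n r d : ℕ) :
    IsFeasible d (r * n) (jacksonCoefMulti (n := n) r) where
  mem_Icc := jacksonCoefMulti_mem_Icc r
  zero_eq := jacksonCoefMulti_zero r
  eq_zero α hα := by
    obtain ⟨i, hi⟩ : ∃ i, r < α i := by
      by_contra! hle
      have : ∑ i, α i ≤ ∑ _i : Fin n, r := Finset.sum_le_sum fun i _ => hle i
      simp only [Finset.sum_const, Finset.card_univ, Fintype.card_fin, smul_eq_mul] at this
      rw [mul_comm] at this
      omega
    exact jacksonCoefMulti_of_lt hi
  conv_mem f hf hpos := by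
    choose P hP hPe using fun (M i : ℕ) => exists_eval_eq_jacksonKernel n r (chebNode_mem_Icc M i)
    -- Enough nodes for exactness in degree `d + rn`.
    let M := d + r * n + 1
    refine ⟨∑ ν ∈ Fintype.piFinset (fun _ : Fin n => Finset.range M),
      C (((M : ℝ)⁻¹) ^ n * eval (fun i => chebNode M (ν i)) f) *
        ∏ i, Polynomial.aeval (X i : MvPolynomial (Fin n) ℝ) (P M (ν i)),
      sum_mem_truncPreordering fun ν _ => C_mul_mem_truncPreordering ?_ ?_, fun x => ?_⟩
    · refine mul_nonneg (by positivity) (hpos _ ?_)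
      exact Set.mem_Icc.mpr ⟨fun i => (chebNode_mem_Icc M (ν i)).1,
        fun i => (chebNode_mem_Icc M (ν i)).2⟩
    · have := prod_mem_truncPreordering (g := boxGen n) Finset.univ
        (fun i => Polynomial.aeval (X i : MvPolynomial (Fin n) ℝ) (P M (ν i))) (fun _ => r)
        fun i _ => hP M (ν i) i
      simpa [mul_comm] using this
    · rw [conv_eq_sum_chebNode (M := M) _ hf (by omega) x, map_sum]
      refine Finset.sum_congr rfl fun ν _ => ?_
      rw [map_mul, eval_C, map_prod, kernel_jacksonCoefMulti, mul_assoc]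
      congr 2
      refine Finset.prod_congr rfl fun i _ => ?_
      rw [← hPe, Polynomial.aeval_def, Polynomial.hom_eval₂, eval_X, Polynomial.eval]
      congr 1
      ext; simp

theorem maxDev_jacksonCoefMulti_le (n : ℕ) {r d : ℕ} (hd : Real.pi * (d : ℝ) < (r : ℝ) + 2) :
    maxDev d (jacksonCoefMulti (n := n) r) ≤ Real.pi ^ 2 * (d : ℝ) ^ 2 / ((r : ℝ) + 2) ^ 2 :=
  Finset.sup'_le _ _ fun α hα => by
    rw [abs_of_nonneg (sub_nonneg.mpr (jacksonCoefMulti_mem_Icc r α).2)]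
    exact one_sub_jacksonCoefMulti_le hd (mem_multiIndices.mp hα)

theorem C_abs_add_C_mul_chebT_mem_boxPreordering (c : ℝ) (α : Fin n → ℕ) :
    C |c| + C c * chebT α ∈ boxPreordering n (∑ i, α i) := by
  rcases le_total 0 c with hc | hc
  · have := C_mul_mem_truncPreordering hc (one_add_chebT_mem_boxPreordering α).1
    rw [abs_of_nonneg hc]
    rwa [mul_add, mul_one] at this
  · have := C_mul_mem_truncPreordering (neg_nonneg.mpr hc) (one_add_chebT_mem_boxPreordering α).2
    rw [abs_of_nonpos hc]
    rwa [mul_sub, mul_one, C_neg, neg_mul, sub_neg_eq_add, ← C_neg] at this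

theorem conv_sub_C {r : ℕ} {l : (Fin n → ℕ) → ℝ} (hl : l 0 = 1) {f : MvPolynomial (Fin n) ℝ}
    (hf : ∀ α ∈ ((chebBasis n).repr f).support, ∑ i, α i ≤ r) (m : ℝ) (x : Fin n → ℝ) :
    conv r l (f - C m) x = ∑ α ∈ ((chebBasis n).repr f).support,
      (chebBasis n).repr f α * (l α * eval x (chebT α)) - m := by
  have hT : chebT (0 : Fin n → ℕ) = 1 := by simp [chebT]
  have h0 : conv r l 1 x = 1 := by
    rw [← hT, conv_chebT l (by simp), hT, hl, map_one, mul_one]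
  -- The constant enters as the extra index `none`, so linearity is applied to a single sum.
  have hsplit : f - C m = ∑ k : Option ((chebBasis n).repr f).support,
      (k.elim (-m) fun α => (chebBasis n).repr f α) •
        (k.elim 1 fun α => chebT (α : Fin n → ℕ)) := by
    rw [Fintype.sum_option]
    simp only [Option.elim_none, Option.elim_some]
    rw [Finset.sum_coe_sort _ fun α => (chebBasis n).repr f α • chebT α, sum_repr_smul_chebT,
      smul_eq_C_mul, mul_one, C_neg]
    ring
  rw [hsplit, conv_sum, Fintype.sum_option]
  simp only [Option.elim_none, Option.elim_some]
  rw [h0, Finset.sum_coe_sort _ fun α => (chebBasis n).repr f α * conv r l (chebT α) x,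
    Finset.sum_congr rfl fun α hα => by rw [conv_chebT l (hf α hα)]]
  ring

/-- A feasible family whose deviation from `1` is at most `ε` on the support of `f` bounds the error
of the hierarchy by `ε ‖f‖_{1,T}`. -/
theorem sub_C_mem_boxPreordering {r d : ℕ} {l : (Fin n → ℕ) → ℝ} (hl : IsFeasible d r l) {ε : ℝ}
    (hε : ∀ α, ∑ i, α i ≤ d → 1 - l α ≤ ε) {f : MvPolynomial (Fin n) ℝ} (hf : f.totalDegree ≤ d)
    (hr : ∀ α ∈ ((chebBasis n).repr f).support, ∑ i, α i ≤ r) :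
    f - C (fmin f - chebNorm f * ε) ∈ boxPreordering n r := by
  set S := ((chebBasis n).repr f).support with hS
  set c := (chebBasis n).repr f with hc
  obtain ⟨p, hp, hpe⟩ := hl.conv_mem (f - C (fmin f))
    ((totalDegree_sub _ _).trans (by simpa using hf)) fun x hx => by
      rw [map_sub, eval_C]
      exact sub_nonneg.mpr ((fmin_isLeast f).2 ⟨x, hx, rfl⟩)
  have hpeq : p = ∑ α ∈ S, C (c α) * (C (l α) * chebT α) - C (fmin f) := by
    refine MvPolynomial.funext fun x => ?_
    rw [hpe, conv_sub_C hl.zero_eq hr]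
    simp [hS, hc]
  have hfeq : f = ∑ α ∈ S, C (c α) * chebT α := by
    conv_lhs => rw [← sum_repr_smul_chebT f]
    simp only [smul_eq_C_mul, hS, hc]
  -- Replacing `λ_α` by `1` costs `(1-λ_α) f_α T_α`, made certifiable by adding `(1-λ_α)|f_α|`; the
  -- budget `ε|f_α|` pays for it and leaves a nonnegative constant.
  have hkey : f - C (fmin f - chebNorm f * ε) =
      p + ∑ α ∈ S, C (1 - l α) * (C |c α| + C (c α) * chebT α) +
        C (∑ α ∈ S, |c α| * (ε - (1 - l α))) := by
    have h1 : chebNorm f * ε = ∑ α ∈ S, |c α| * ε := by rw [chebNorm, Finset.sum_mul]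
    have h2 : f + C (chebNorm f * ε) = ∑ α ∈ S, C (c α) * (C (l α) * chebT α) +
        ∑ α ∈ S, C (1 - l α) * (C |c α| + C (c α) * chebT α) +
          C (∑ α ∈ S, |c α| * (ε - (1 - l α))) := by
      nth_rewrite 1 [hfeq]
      rw [h1]
      simp only [map_sub, map_sum, map_mul, map_one, ← Finset.sum_add_distrib]
      exact Finset.sum_congr rfl fun α _ => by ring
    rw [hpeq, C_sub]
    linear_combination h2
  rw [hkey]
  refine add_mem_truncPreordering (add_mem_truncPreordering hp
    (sum_mem_truncPreordering fun α hα => ?_)) (C_mem_truncPreordering (Finset.sum_nonneg ?_))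
  · exact C_mul_mem_truncPreordering (sub_nonneg.mpr (hl.mem_Icc α).2)
      (truncPreordering_mono (hr α hα) (C_abs_add_C_mul_chebT_mem_boxPreordering _ _))
  · exact fun α hα => mul_nonneg (abs_nonneg _)
      (sub_nonneg.mpr (hε α ((sum_le_totalDegree_of_mem_support hα).trans hf)))

theorem fmin_sub_lowerBound_le {f : MvPolynomial (Fin n) ℝ} {r : ℕ} {E : ℝ}
    (h : f - C (fmin f - E) ∈ boxPreordering n r) :
    (fmin f : EReal) - lowerBound f r ≤ (E : EReal) := by
  have hle : ((fmin f - E : ℝ) : EReal) ≤ lowerBound f r := le_sSup ⟨_, h, rfl⟩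
  refine (EReal.sub_le_sub le_rfl hle).trans ?_
  rw [← EReal.coe_sub, sub_sub_cancel]

end Hierarchy

end HypercubeHierarchy

end

open HypercubeHierarchy in
theorem proposition2 (n r d : ℕ) (hd : Real.pi * (d : ℝ) < (r : ℝ) + 2) :
    -- the bound on `Θ`
    Theta n d (r * n) ≤ ((Real.pi ^ 2 * (d : ℝ) ^ 2 / ((r : ℝ) + 2) ^ 2 : ℝ) : EReal) ∧
    -- it is witnessed by the product of univariate Jackson kernels
    ((∀ x y : Fin n → ℝ,
        kernel (r * n) (jacksonCoefMulti r) x y = ∏ i, jacksonKernel r (x i) (y i)) ∧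
      IsFeasible d (r * n) (jacksonCoefMulti (n := n) r) ∧
      maxDev d (jacksonCoefMulti (n := n) r) ≤ Real.pi ^ 2 * (d : ℝ) ^ 2 / ((r : ℝ) + 2) ^ 2) ∧
    -- the resulting error bound for the hierarchy
    (∀ f : MvPolynomial (Fin n) ℝ, f.totalDegree ≤ d →
      (fmin f : EReal) - lowerBound f (r * n) ≤
        ((chebNorm f * (Real.pi ^ 2 * (d : ℝ) ^ 2 / ((r : ℝ) + 2) ^ 2) : ℝ) : EReal)) := by
  have hfeas := isFeasible_jacksonCoefMulti n r d
  have hdev := maxDev_jacksonCoefMulti_le n hd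
  refine ⟨?_, ⟨fun x y => kernel_jacksonCoefMulti r x y, hfeas, hdev⟩, fun f hf => ?_⟩
  · exact (sInf_le (Set.mem_image_of_mem _ hfeas)).trans (EReal.coe_le_coe_iff.mpr hdev)
  -- `π > 3` gives `3d < r + 2`, so the degrees in `f` fit the level `rn` when `n ≥ 1`.
  · have hdr : d ≤ r := by
      have h1 : 3 * (d : ℝ) < (r : ℝ) + 2 :=
        lt_of_le_of_lt (mul_le_mul_of_nonneg_right Real.pi_gt_three.le (by positivity)) hd
      have h2 : 3 * d < r + 2 := by exact_mod_cast h1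
      omega
    refine fmin_sub_lowerBound_le (sub_C_mem_boxPreordering hfeas
      (fun α hα => one_sub_jacksonCoefMulti_le hd hα) hf fun α hα => ?_)
    have hα := (sum_le_totalDegree_of_mem_support hα).trans hf
    -- For `n = 0` the level is `0`, but so is the degree of the empty multi-index.
    rcases Nat.eq_zero_or_pos n with rfl | hn
    · simp
    · exact (hα.trans hdr).trans (Nat.le_mul_of_pos_right r hn)
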